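/- Let $d\ge 0$ be an integer and let $\Lambda\subset\mathbb{R}^d$ be a Delone set (uniformly discrete and relatively dense). Write $U_R(x)$ for the open ball of radius $R$ around $x$. Assume that $\Lambda$ is linearly repetitive: there is $C>0$ such that for all $R\ge 1$, $x\in\mathbb{R}^d$ and $y\in\Lambda$ there is $z\in U_{CR}(x)\cap\Lambda$ with $(-z+\Lambda)\cap U_R(0)=(-y+\Lambda)\cap U_R(0)$. Identify a locally finite set $\Gamma\subset\mathbb{R}^d$ with the measure $\sum_{x\in\Gamma}\delta_x$, let the hull $\Omega(\Lambda)$ be the closure of $\{t+\Lambda : t\in\mathbb{R}^d\}$ in the vague topology, and let $\mathbb{R}^d$ act on $\Omega(\Lambda)$ by $\alpha_t\Gamma=t+\Gamma$. Let $m$ be an $\alpha$-invariant Borel probability measure on $\Omega(\Lambda)$ (it is in fact unique), and let $T$ be the unitary representation $(T_tg)(\Gamma)=g(\alpha_{-t}\Gamma)$ of $\mathbb{R}^d$ on $L^2(\Omega(\Lambda),m)$. Let $E_T$ be its spectral measure, that is, the projection-valued measure on the Borel sets of $\mathbb{R}^d$ with $\langle g,T_tg\rangle=\int e^{i\eta\cdot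 t}\,d\langle g,E_T(\eta)g\rangle$ for all $g\in L^2(\Omega(\Lambda),m)$ and $t\in\mathbb{R}^d$; thus $E_T(\{\xi\})$ is the orthogonal projection onto $\{g : T_tg=e^{i\xi\cdot t}g \text{ for all } t\in\mathbb{R}^d\}$. For $r\in\mathbb{R}$ let $\mathcal{B}(r)$ be the set of boxes $I_1\times\dots\times I_d$, with nonempty bounded intervals $I_j\subset\mathbb{R}$, all of whose side lengths lie between $r$ and $2r$. For $\xi\in\mathbb{R}^d$, a continuous function $f:\Omega(\Lambda)\to\mathbb{C}$ and a box $Q$ of positive volume $|Q|$ put $$A^\xi_Q(f)(\Gamma)=\frac1{|Q|}\int_Q e^{-i\xi\cdot s}f(\alpha_{-s}\Gamma)\,ds .$$ Then for every $\xi\in\mathbb{R}^d$, every continuous $f:\Omega(\Lambda)\to\mathbb{C}$, every real sequence $r_n\to\infty$ and all boxes $Q_n\in\mathcal{B}(r_n)$, the functions $|A^\xi_{Q_n}(f)|$ converge, as $n\to\infty$, uniformly on $\Omega(\Lambda)$ to the constant $$\|E_T(\{\xi\})f\|=\sqrt{\langle E_T(\{\xi\})f,E_T(\{\xi\})f\rangle}.$$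 -/

import Mathlib

open MeasureTheory Filter Topology
open scoped CompactlySupported ENNReal

noncomputable section

namespace LinRep

/-! ### Discrete point sets and the vague topology -/

/-- Euclidean space `ℝ^d`. -/
abbrev Eu (d : ℕ) : Type := EuclideanSpace ℝ (Fin d)

/-- A discrete (i.e. locally finite) point set in `ℝ^d`: every compact set contains only finitely
many of its points. -/
structure PointSet (d : ℕ) where
  carrier : Set (Eu d)
  finite_inter : ∀ K : Set (Eu d), IsCompact K → (carrier ∩ K).Finite

variable {d : ℕ}

/-- The integral of `φ ∈ C_c(ℝ^d)` against the Dirac comb `∑_{x ∈ Γ} δ_x` of the point set `Γ`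
(a sum with only finitely many nonzero terms). -/
def PointSet.pair (Γ : PointSet d) (φ : C_c(Eu d, ℂ)) : ℂ := ∑' x : Γ.carrier, φ x

/-- The vague topology: the coarsest topology for which all the maps
`Γ ↦ ∑_{x ∈ Γ} φ x`, `φ ∈ C_c(ℝ^d)`, are continuous. -/
instance : TopologicalSpace (PointSet d) :=
  TopologicalSpace.induced (fun Γ => Γ.pair) (inferInstance : TopologicalSpace (C_c(Eu d, ℂ) → ℂ))

instance : MeasurableSpace (PointSet d) := borel _

instance : BorelSpace (PointSet d) := ⟨rfl⟩

/-- The translate `t + Γ`. -/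
def PointSet.translate (t : Eu d) (Γ : PointSet d) : PointSet d where
  carrier := (fun x => t + x) '' Γ.carrier
  finite_inter K hK := by
    refine ((Γ.finite_inter ((fun x => -t + x) '' K)
      (hK.image (by fun_prop))).image (fun x => t + x)).subset ?_
    rintro _ ⟨⟨x, hx, rfl⟩, hxK⟩
    exact ⟨x, ⟨hx, ⟨t + x, hxK, by simp⟩⟩, rfl⟩

theorem PointSet.ext' {Γ Γ' : PointSet d} (h : Γ.carrier = Γ'.carrier) : Γ = Γ' := by
  cases Γ; cases Γ'; simp_all

theorem PointSet.translate_translate (s t : Eu d) (Γ : PointSet d) :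
    (Γ.translate t).translate s = Γ.translate (s + t) := by
  apply PointSet.ext'
  change (fun x => s + x) '' ((fun x => t + x) '' Γ.carrier) = (fun x => s + t + x) '' Γ.carrier
  rw [Set.image_image]
  simp only [add_assoc]

theorem PointSet.continuous_translate (t : Eu d) :
    Continuous (PointSet.translate t : PointSet d → PointSet d) := by
  refine continuous_induced_rng.2 (continuous_pi fun φ => ?_)
  let ψ : C_c(Eu d, ℂ) :=
    { toFun := fun x => φ (t + x)
      continuous_toFun := by fun_prop
      hasCompactSupport' := φ.hasCompactSupport.comp_homeomorph (Homeomorph.addLeft t) }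
  have h : Continuous fun Γ : PointSet d => Γ.pair ψ :=
    (continuous_apply ψ).comp
      (continuous_induced_dom (f := fun Γ : PointSet d => Γ.pair))
  convert h using 2 with Γ
  have hinj : Set.InjOn (fun x : Eu d => t + x) Γ.carrier := fun x _ y _ hxy => by simpa using hxy
  exact ((Equiv.Set.imageOfInjOn (fun x => t + x) Γ.carrier hinj).tsum_eq
    (fun x : (fun x => t + x) '' Γ.carrier => φ x)).symm

/-- The underlying locally finite point set of a Delone set. -/
def ofDelone (Λ : Delone.DeloneSet (Eu d)) : PointSet d where
  carrier := Λ
  finite_inter K hK := by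
    have hp : (0 : ℝ) < (Λ.packingRadius / 2 : NNReal) := by
      exact_mod_cast half_pos Λ.packingRadius_pos
    obtain ⟨t, ht, hKt⟩ := Metric.totallyBounded_iff.1 hK.totallyBounded _ hp
    have hsub : (Λ : Set (Eu d)) ∩ K ⊆
        ⋃ y ∈ t, ((Λ : Set (Eu d)) ∩ Metric.ball y (Λ.packingRadius / 2 : NNReal)) := by
      rintro x ⟨hx, hxK⟩
      obtain ⟨y, hy, hxy⟩ := Set.mem_iUnion₂.1 (hKt hxK)
      exact Set.mem_iUnion₂.2 ⟨y, hy, hx, hxy⟩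
    refine (ht.biUnion fun y _ => Set.Subsingleton.finite ?_).subset hsub
    rintro a ⟨ha, ha'⟩ b ⟨hb, hb'⟩
    exact Λ.eq_of_mem_ball le_rfl ha hb ha' hb'

/-! ### The hull, linear repetitivity and boxes -/

/-- The hull `Ω(Λ)`: the closure of the set of all translates of `Λ` in the vague topology. -/
def hull (Λ : Delone.DeloneSet (Eu d)) : Set (PointSet d) :=
  closure (Set.range fun t => (ofDelone Λ).translate t)

theorem translate_mem_hull {Λ : Delone.DeloneSet (Eu d)} (t : Eu d) {Γ : PointSet d}
    (hΓ : Γ ∈ hull Λ) : Γ.translate t ∈ hull Λ := by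
  refine map_mem_closure (PointSet.continuous_translate t) hΓ ?_
  rintro _ ⟨s, rfl⟩
  exact ⟨t + s, (PointSet.translate_translate t s _).symm⟩

/-- The translation action `α_t Γ = t + Γ` on the hull. -/
def shift (Λ : Delone.DeloneSet (Eu d)) (t : Eu d) (Γ : hull Λ) : hull Λ :=
  ⟨Γ.1.translate t, translate_mem_hull t Γ.2⟩

/-- Linear repetitivity: for some `C > 0`, every patch of `Λ` of radius `R ≥ 1` around a point of
`Λ` reoccurs around some point of `Λ` in every open ball of radius `C R`. -/
def LinearlyRepetitive (Λ : Delone.DeloneSet (Eu d)) : Prop :=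
  ∃ C : ℝ, 0 < C ∧ ∀ R : ℝ, 1 ≤ R → ∀ x : Eu d, ∀ y ∈ Λ, ∃ z ∈ Λ, z ∈ Metric.ball x (R * C) ∧
    (fun p => -z + p) '' (Λ : Set (Eu d)) ∩ Metric.ball 0 R =
      (fun p => -y + p) '' (Λ : Set (Eu d)) ∩ Metric.ball 0 R

/-- The boxes `I_1 × ⋯ × I_d`, with `I_j` nonempty bounded intervals, all of whose side lengths
lie between `r` and `2 r`. -/
def boxes (d : ℕ) (r : ℝ) : Set (Set (Eu d)) :=
  {Q | ∃ I : Fin d → Set ℝ,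
    (∀ j, (I j).Nonempty ∧ (I j).OrdConnected ∧ Bornology.IsBounded (I j) ∧
      r ≤ Metric.diam (I j) ∧ Metric.diam (I j) ≤ 2 * r) ∧
    Q = {x | ∀ j, x j ∈ I j}}

/-! ### Averages -/

/-- The character `t ↦ exp (i ξ·t)` of `ℝ^d` given by `ξ ∈ ℝ^d`. -/
def char (ξ t : Eu d) : ℂ := Complex.exp (Complex.I * (inner ℝ ξ t : ℝ))

/-- The average `A^ξ_B(f)(Γ) = |B|⁻¹ ∫_B conj (ξ, s) f(α_{-s} Γ) ds`. -/
def average {Λ : Delone.DeloneSet (Eu d)} (ξ : Eu d) (B : Set (Eu d)) (f : hull Λ → ℂ)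
    (Γ : hull Λ) : ℂ :=
  ((volume B).toReal : ℂ)⁻¹ * ∫ s in B, (starRingEnd ℂ) (char ξ s) * f (shift Λ (-s) Γ)

/-! ### Projection-valued measures and the spectral measure of the translation action -/

/-- A projection-valued measure on the measurable subsets of `X` with values in the orthogonal
projections of the Hilbert space `H`, countably additive in the strong sense. The values on
non-measurable sets are irrelevant. -/
structure ProjectionValuedMeasure (X : Type*) [MeasurableSpace X] (H : Type*)
    [NormedAddCommGroup H] [InnerProductSpace ℂ H] [CompleteSpace H] where
  proj : Set X → H →L[ℂ] H
  isStarProjection : ∀ B, MeasurableSet B → IsStarProjection (proj B)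
  univ : proj Set.univ = 1
  inter : ∀ A B, MeasurableSet A → MeasurableSet B → proj (A ∩ B) = proj A * proj B
  iUnion : ∀ B : ℕ → Set X, (∀ n, MeasurableSet (B n)) → Pairwise (Function.onFun Disjoint B) →
    ∀ g : H, HasSum (fun n => proj (B n) g) (proj (⋃ n, B n) g)

section PVM

variable {X : Type*} [MeasurableSpace X] {H : Type*}
    [NormedAddCommGroup H] [InnerProductSpace ℂ H] [CompleteSpace H]

theorem ProjectionValuedMeasure.empty (E : ProjectionValuedMeasure X H) (g : H) :
    E.proj ∅ g = 0 := by
  have h := E.iUnion (fun _ => ∅) (fun _ => MeasurableSet.empty)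
    (fun _ _ _ => disjoint_bot_left) g
  exact (summable_const_iff _).1 h.summable

theorem ProjectionValuedMeasure.nonneg (E : ProjectionValuedMeasure X H) (g : H) {B : Set X}
    (hB : MeasurableSet B) : 0 ≤ (inner ℂ g (E.proj B g)).re := by
  have h := E.isStarProjection B hB
  have h1 : E.proj B (E.proj B g) = E.proj B g := DFunLike.congr_fun h.isIdempotentElem g
  have h2 : inner ℂ (E.proj B g) (E.proj B g) = inner ℂ g (E.proj B (E.proj B g)) := by
    have := ContinuousLinearMap.adjoint_inner_left (E.proj B) (E.proj B g) g
    rw [← ContinuousLinearMap.star_eq_adjoint, h.isSelfAdjoint.star_eq] at this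
    exact this
  rw [h1] at h2
  rw [← h2]
  exact inner_self_nonneg (𝕜 := ℂ)

/-- The measure `ρ_g(B) = ⟨g, E(B) g⟩`. -/
def ProjectionValuedMeasure.diag (E : ProjectionValuedMeasure X H) (g : H) : Measure X :=
  Measure.ofMeasurable (fun B _ => ENNReal.ofReal (inner ℂ g (E.proj B g)).re)
    (by simp [E.empty])
    (by
      intro B hB hd
      have h := (E.iUnion B hB hd g).mapL (innerSL ℂ g)
      have h' := Complex.hasSum_re h
      have h'' : HasSum (fun n => (inner ℂ g (E.proj (B n) g)).re)
        (inner ℂ g (E.proj (⋃ n, B n) g)).re := by simpa using h'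
      rw [← h''.tsum_eq]
      exact ENNReal.ofReal_tsum_of_nonneg (fun n => E.nonneg g (hB n)) h''.summable)

end PVM

section Spectral

variable {Λ : Delone.DeloneSet (Eu d)} {m : Measure (hull Λ)}

/-- The unitary representation `(T_t g)(Γ) = g(α_{-t} Γ)` on `L²(Ω(Λ), m)`, for an invariant
measure `m`. -/
def koopman (hm : ∀ t, MeasurePreserving (shift Λ t) m m) (t : Eu d) :
    Lp ℂ 2 m →ₗᵢ[ℂ] Lp ℂ 2 m :=
  Lp.compMeasurePreservingₗᵢ ℂ (shift Λ (-t)) (hm (-t))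

/-- `E` is the spectral measure `E_T` of the representation `T` (with the dual group of `ℝ^d`
identified with `ℝ^d`): `⟨g, T_t g⟩ = ∫ (η, t) dρ_g(η)` with `ρ_g(B) = ⟨g, E(B) g⟩`. -/
def IsSpectralMeasure (hm : ∀ t, MeasurePreserving (shift Λ t) m m)
    (E : ProjectionValuedMeasure (Eu d) (Lp ℂ 2 m)) : Prop :=
  ∀ (g : Lp ℂ 2 m) (t : Eu d), inner ℂ g (koopman hm t g) = ∫ η, char η t ∂(E.diag g)

/-- The closed subspace of all `g` with `T_t g = (ξ, t) g` for every `t`. -/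
def eigenspace (hm : ∀ t, MeasurePreserving (shift Λ t) m m) (ξ : Eu d) :
    ClosedSubmodule ℂ (Lp ℂ 2 m) where
  carrier := {g | ∀ t, koopman hm t g = char ξ t • g}
  add_mem' := by
    intro a b ha hb t
    rw [map_add, ha t, hb t, smul_add]
  zero_mem' := by intro t; simp
  smul_mem' := by
    intro c a ha t
    rw [map_smul, ha t, smul_comm]
  isClosed' := by
    have : {g | ∀ t, koopman hm t g = char ξ t • g} =
        ⋂ t, {g : Lp ℂ 2 m | koopman hm t g = char ξ t • g} := by ext; simp
    change IsClosed {g | ∀ t, koopman hm t g = char ξ t • g}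
    rw [this]
    exact isClosed_iInter fun t =>
      isClosed_eq (koopman hm t).continuous (continuous_const_smul _)

end Spectral

end LinRep

end

/-! Everything is read off one orbit. Put k(x) = conj (ξ, x) f(α_{-x} Λ). Up to a phase, the average
of f over Q at t + Λ is the average of k over Q - t. An estimate for k that is uniform in the
position of the box therefore holds uniformly on the dense orbit of Λ, and by continuity on the
hull.

Since f(Γ) is determined up to ε by a large patch of Γ around the origin, linear repetitivity passes
to k (`orbitFun_repetitive`): the behaviour of k on any ball of radius R recurs within distance O(R)
of any point, up to a small error and a constant phase. Because of the phase only moduli can be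
compared, and |∫_P k| is subadditive when a box P is cut. Let c be the infimum of the β with |∫_P k|
≤ β|P| for all boxes P with sufficiently long sides. Averages over large boxes are then at most c +
ε. If a large box Q with sides in [r, 2r] had average modulus below c - δ, every box with sides in
[Kr, 2Kr] would contain a near copy of Q, filling a fixed fraction of its volume. The rest is cut
into boxes with averages hardly above c, so the whole average drops below c by a fixed amount. All
longer boxes are tiled by such cells, which contradicts the choice of c
(`exists_tendsto_boxAverage`). No measure enters, so c does not depend on m.

To identify c, let P be the projection onto the fixed vectors of the isometries conj (ξ, t) T_t,
that is, onto the eigenspace. Averaging f does not change Pf, so ‖Pf‖ is at most the L² norm of the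
averages, which tends to c. Conversely, Pf is an L² limit of convex combinations φ of twisted
translates of f. Such a φ has asymptotically the same averages over large cubes as f, and averaging
is a contraction, so c ≤ ‖φ‖ (`eq_norm_starProjection`). Finally E({ξ}) = P, by uniqueness of
characteristic functions (`starProjection_eigenspace_eq`). -/

noncomputable section

namespace LinRep

variable {d : ℕ}

/-! ### The vague topology on point sets -/

/-- The tent function of height one centred at `x` and supported in the closed ball of radius
`δ`. -/
def tent (x : Eu d) {δ : ℝ} (hδ : 0 < δ) : C_c(Eu d, ℂ) where
  toFun y := ((max 0 (1 - dist y x / δ) : ℝ) : ℂ)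
  continuous_toFun := by fun_prop
  hasCompactSupport' := by
    refine HasCompactSupport.intro (isCompact_closedBall x δ) fun y hy => ?_
    have : δ < dist y x := by simpa using hy
    have : 1 < dist y x / δ := by rwa [one_lt_div hδ]
    have : max 0 (1 - dist y x / δ) = 0 := max_eq_left (by linarith)
    simp [this]

theorem tent_apply (x : Eu d) {δ : ℝ} (hδ : 0 < δ) (y : Eu d) :
    tent x hδ y = ((max 0 (1 - dist y x / δ) : ℝ) : ℂ) := rfl

theorem tent_eq_zero (x : Eu d) {δ : ℝ} (hδ : 0 < δ) {y : Eu d} (h : δ ≤ dist y x) :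
    tent x hδ y = 0 := by
  have : 1 ≤ dist y x / δ := by rwa [one_le_div hδ]
  rw [tent_apply, max_eq_left (by linarith)]
  simp

theorem PointSet.finite_support (Γ : PointSet d) (φ : C_c(Eu d, ℂ)) :
    {x : Γ.carrier | φ x ≠ 0}.Finite := by
  refine Set.Finite.of_finite_image (f := Subtype.val) ?_ Subtype.val_injective.injOn
  refine (Γ.finite_inter (tsupport φ) φ.hasCompactSupport).subset ?_
  rintro _ ⟨x, hx, rfl⟩
  exact ⟨x.2, subset_tsupport _ hx⟩

theorem PointSet.summable (Γ : PointSet d) (φ : C_c(Eu d, ℂ)) :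
    Summable fun x : Γ.carrier => φ x :=
  summable_of_hasFiniteSupport (Γ.finite_support φ)

theorem PointSet.continuous_pair (φ : C_c(Eu d, ℂ)) :
    Continuous fun Γ : PointSet d => Γ.pair φ :=
  (continuous_apply φ).comp (continuous_induced_dom (f := fun Γ : PointSet d => Γ.pair))

theorem PointSet.exists_isolated (Γ : PointSet d) (x : Eu d) :
    ∃ δ : ℝ, 0 < δ ∧ ∀ y ∈ Γ.carrier, y ≠ x → δ ≤ dist y x := by
  have hfin : ((Γ.carrier ∩ Metric.closedBall x 1) \ {x}).Finite :=
    (Γ.finite_inter _ (isCompact_closedBall x 1)).subset Set.sdiff_subset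
  have hx : ((Γ.carrier ∩ Metric.closedBall x 1) \ {x})ᶜ ∈ 𝓝 x :=
    hfin.isClosed.isOpen_compl.mem_nhds (by simp)
  obtain ⟨ε, hε, h⟩ := Metric.mem_nhds_iff.1 hx
  refine ⟨min ε 1, lt_min hε one_pos, fun y hy hne => ?_⟩
  by_contra! hlt
  exact h (Metric.mem_ball.2 (hlt.trans_le (min_le_left _ _)))
    ⟨⟨hy, Metric.mem_closedBall.2 (hlt.le.trans (min_le_right _ _))⟩, hne⟩

/-- A tent no wider than the gap around `x` sees no other point, so pairings detect membership. This
makes the vague topology Hausdorff. -/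
theorem PointSet.pair_tent_eq_ite (Γ : PointSet d) (x : Eu d) {δ : ℝ} (hδ : 0 < δ)
    (h : ∀ y ∈ Γ.carrier, y ≠ x → δ ≤ dist y x) [Decidable (x ∈ Γ.carrier)] :
    Γ.pair (tent x hδ) = if x ∈ Γ.carrier then 1 else 0 := by
  split_ifs with hx
  · rw [PointSet.pair, tsum_eq_single ⟨x, hx⟩]
    · simp [tent_apply]
    · intro y hy
      exact tent_eq_zero x hδ (h y y.2 fun h => hy (Subtype.ext h))
  · rw [PointSet.pair]
    refine (tsum_congr fun y : Γ.carrier => tent_eq_zero x hδ (h y y.2 ?_)).trans tsum_zero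
    rintro rfl
    exact hx y.2

theorem PointSet.carrier_subset_of_pair_eq {Γ Γ' : PointSet d} (h : Γ.pair = Γ'.pair) :
    Γ.carrier ⊆ Γ'.carrier := by
  classical
  intro x hx
  obtain ⟨δ, hδ, h1⟩ := Γ.exists_isolated x
  obtain ⟨δ', hδ', h2⟩ := Γ'.exists_isolated x
  have hm : 0 < min δ δ' := lt_min hδ hδ'
  have e1 := Γ.pair_tent_eq_ite x hm fun y hy hne => (min_le_left _ _).trans (h1 y hy hne)
  have e2 := Γ'.pair_tent_eq_ite x hm fun y hy hne => (min_le_right _ _).trans (h2 y hy hne)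
  rw [h, e2, if_pos hx] at e1
  by_contra hx'
  simp [hx'] at e1

theorem PointSet.pair_injective : Function.Injective (PointSet.pair (d := d)) := fun _ _ h =>
  PointSet.ext' ((PointSet.carrier_subset_of_pair_eq h).antisymm
    (PointSet.carrier_subset_of_pair_eq h.symm))

instance : T2Space (PointSet d) :=
  T2Space.of_injective_continuous PointSet.pair_injective continuous_induced_dom

/-- The point sets any two points of which have distance at least `r`. -/
def separated (d : ℕ) (r : ℝ) : Set (PointSet d) :=
  {Γ | ∀ x ∈ Γ.carrier, ∀ y ∈ Γ.carrier, x ≠ y → r ≤ dist x y}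

theorem finite_inter_of_le_dist {r : ℝ} (hr : 0 < r) {A : Set (Eu d)}
    (hA : ∀ x ∈ A, ∀ y ∈ A, x ≠ y → r ≤ dist x y) {K : Set (Eu d)} (hK : IsCompact K) :
    (A ∩ K).Finite := by
  obtain ⟨t, ht, hKt⟩ := Metric.totallyBounded_iff.1 hK.totallyBounded _ (half_pos hr)
  refine (ht.biUnion fun y _ => Set.Subsingleton.finite
    (s := A ∩ Metric.ball y (r / 2)) ?_).subset ?_
  · rintro a ⟨ha, ha'⟩ b ⟨hb, hb'⟩
    by_contra hne
    have := dist_triangle_right a b y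
    have h1 := hA a ha b hb hne
    rw [Metric.mem_ball] at ha' hb'
    linarith
  · rintro x ⟨hx, hxK⟩
    obtain ⟨y, hy, hxy⟩ := Set.mem_iUnion₂.1 (hKt hxK)
    exact Set.mem_iUnion₂.2 ⟨y, hy, hx, hxy⟩

/-- The limit of an ultrafilter of separated point sets. -/
def limitCarrier (𝒰 : Ultrafilter (PointSet d)) : Set (Eu d) :=
  {x | ∀ ε > 0, ∀ᶠ Γ in (𝒰 : Filter (PointSet d)), (Γ.carrier ∩ Metric.ball x ε).Nonempty}

theorem le_dist_of_mem_limitCarrier {r : ℝ} {𝒰 : Ultrafilter (PointSet d)}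
    (h𝒰 : ∀ᶠ Γ in (𝒰 : Filter (PointSet d)), Γ ∈ separated d r) {x y : Eu d}
    (hx : x ∈ limitCarrier 𝒰) (hy : y ∈ limitCarrier 𝒰) (hne : x ≠ y) : r ≤ dist x y := by
  by_contra! hlt
  have hpos := dist_pos.2 hne
  obtain ⟨ε, hε, h1, h2⟩ : ∃ ε > 0, dist x y + 2 * ε < r ∧ 2 * ε < dist x y := by
    refine ⟨min ((r - dist x y) / 4) (dist x y / 4), lt_min (by linarith) (by linarith), ?_, ?_⟩
    · linarith [min_le_left ((r - dist x y) / 4) (dist x y / 4)]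
    · linarith [min_le_right ((r - dist x y) / 4) (dist x y / 4)]
  obtain ⟨Γ, hΓ, ⟨a, ha, hax⟩, ⟨b, hb, hby⟩⟩ := (h𝒰.and ((hx ε hε).and (hy ε hε))).exists
  rw [Metric.mem_ball] at hax hby
  have hab : a ≠ b := by
    rintro rfl
    linarith [dist_triangle_left x y a]
  have := hΓ a ha b hb hab
  linarith [dist_triangle4 a x y b, dist_comm y b]

/-- By separation, each limit point eventually has exactly one point of `Γ` close to it, which
converges to it. The rest of the support of a test function is eventually empty, so the finite sums
converge termwise. -/
theorem exists_limit {r : ℝ} (hr : 0 < r) (𝒰 : Ultrafilter (PointSet d))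
    (h𝒰 : ∀ᶠ Γ in (𝒰 : Filter (PointSet d)), Γ ∈ separated d r) :
    ∃ Γ ∈ separated d r, (𝒰 : Filter (PointSet d)) ≤ 𝓝 Γ := by
  classical
  have hsep : ∀ x ∈ limitCarrier 𝒰, ∀ y ∈ limitCarrier 𝒰, x ≠ y → r ≤ dist x y :=
    fun x hx y hy => le_dist_of_mem_limitCarrier h𝒰 hx hy
  let Γ₀ : PointSet d := ⟨limitCarrier 𝒰, fun K hK => finite_inter_of_le_dist hr hsep hK⟩
  refine ⟨Γ₀, hsep, ?_⟩
  rw [nhds_induced, ← tendsto_iff_comap, tendsto_pi_nhds]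
  intro φ
  have hr4 : 0 < r / 4 := by linarith
  let S : Finset (Eu d) := (Γ₀.finite_inter _ φ.hasCompactSupport).toFinset
  have hS : ∀ x, x ∈ S ↔ x ∈ limitCarrier 𝒰 ∧ x ∈ tsupport φ := fun x => by
    simp [S, Γ₀]
  -- The point of `Γ` near `x`, unique at scale `r / 4`; the default `x` is eventually not used for
  -- `x ∈ S`.
  let p : Eu d → PointSet d → Eu d := fun x Γ =>
    if h : (Γ.carrier ∩ Metric.ball x (r / 4)).Nonempty then h.some else x
  have hp : ∀ x ∈ S, ∀ᶠ Γ in (𝒰 : Filter (PointSet d)),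
      p x Γ ∈ Γ.carrier ∧ p x Γ ∈ Metric.ball x (r / 4) := fun x hx => by
    filter_upwards [((hS x).1 hx).1 _ hr4] with Γ hΓ
    simp only [p, dif_pos hΓ]
    exact hΓ.some_mem
  have huniq : ∀ Γ ∈ separated d r, ∀ x, ∀ y ∈ Γ.carrier, ∀ z ∈ Γ.carrier,
      y ∈ Metric.ball x (r / 4) → z ∈ Metric.ball x (r / 4) → y = z := by
    intro Γ hΓ x y hy z hz hyx hzx
    by_contra hne
    rw [Metric.mem_ball] at hyx hzx
    linarith [hΓ y hy z hz hne, dist_triangle_right y z x]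
  have hlim : ∀ x ∈ S, Tendsto (p x) 𝒰 (𝓝 x) := by
    intro x hx
    rw [Metric.tendsto_nhds]
    intro ε hε
    filter_upwards [h𝒰, hp x hx, ((hS x).1 hx).1 (min ε (r / 4)) (lt_min hε hr4)]
      with Γ hΓ hpΓ hne
    obtain ⟨y, hy, hyx⟩ := hne
    rw [huniq Γ hΓ x _ hpΓ.1 y hy hpΓ.2 (Metric.ball_subset_ball (min_le_right _ _) hyx)]
    exact (Metric.mem_ball.1 hyx).trans_le (min_le_left _ _)
  -- A non-limit point has a ball that eventually misses `Γ`, because an ultrafilter decides;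
  -- finitely many such balls cover the compact remainder.
  have hcov : ∀ᶠ Γ in (𝒰 : Filter (PointSet d)),
      ∀ y ∈ Γ.carrier, y ∉ tsupport φ \ ⋃ x ∈ S, Metric.ball x (r / 4) := by
    have hK : IsCompact (tsupport φ \ ⋃ x ∈ S, Metric.ball x (r / 4)) :=
      φ.hasCompactSupport.isCompact.diff (isOpen_biUnion fun _ _ => Metric.isOpen_ball)
    refine hK.induction_on (p := fun s => ∀ᶠ Γ in (𝒰 : Filter (PointSet d)),
      ∀ y ∈ Γ.carrier, y ∉ s) (by simp) ?_ ?_ ?_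
    · intro s t hst ht
      filter_upwards [ht] with Γ hΓ y hy hys using hΓ y hy (hst hys)
    · intro s t hs ht
      filter_upwards [hs, ht] with Γ h1 h2 y hy hyst
      exact hyst.elim (h1 y hy) (h2 y hy)
    · rintro x ⟨hxφ, hxS⟩
      have hx : x ∉ limitCarrier 𝒰 := fun hx => hxS <|
        Set.mem_biUnion ((hS x).2 ⟨hx, hxφ⟩) (Metric.mem_ball_self hr4)
      simp only [limitCarrier, Set.mem_ofPred_eq, not_forall] at hx
      obtain ⟨ε, hε, hx⟩ := hx
      refine ⟨Metric.ball x ε, mem_nhdsWithin_of_mem_nhds (Metric.ball_mem_nhds x hε), ?_⟩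
      filter_upwards [Ultrafilter.eventually_not.2 hx] with Γ hΓ y hy hyx
      exact hΓ ⟨y, hy, hyx⟩
  have hpair₀ : Γ₀.pair φ = ∑ x ∈ S, φ x := by
    have h1 : ∀ x ∉ S, Γ₀.carrier.indicator φ x = 0 := by
      intro x hx
      by_cases hxc : x ∈ Γ₀.carrier
      · rw [Set.indicator_of_mem hxc]
        exact image_eq_zero_of_notMem_tsupport fun h => hx ((hS x).2 ⟨hxc, h⟩)
      · exact Set.indicator_of_notMem hxc _
    rw [PointSet.pair, tsum_subtype Γ₀.carrier φ, tsum_eq_sum h1]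
    exact Finset.sum_congr rfl fun x hx => Set.indicator_of_mem ((hS x).1 hx).1 _
  have hpair : ∀ᶠ Γ in (𝒰 : Filter (PointSet d)), ∑ x ∈ S, φ (p x Γ) = Γ.pair φ := by
    filter_upwards [h𝒰, (Finset.eventually_all S).2 hp, hcov] with Γ hΓ hpΓ hcΓ
    have hinj : Set.InjOn (fun x => p x Γ) S := by
      intro x hx y hy hxy
      by_contra hne
      have h1 := Metric.mem_ball.1 (hpΓ x hx).2
      have h2 := Metric.mem_ball.1 (hpΓ y hy).2
      simp only at hxy
      rw [hxy] at h1
      have := hsep x ((hS x).1 hx).1 y ((hS y).1 hy).1 hne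
      linarith [dist_triangle_left x y (p y Γ)]
    have h1 : ∀ y ∉ S.image (fun x => p x Γ), Γ.carrier.indicator φ y = 0 := by
      intro y hy
      by_cases hyc : y ∈ Γ.carrier
      · rw [Set.indicator_of_mem hyc]
        refine image_eq_zero_of_notMem_tsupport fun h => hcΓ y hyc ⟨h, fun hyS => hy ?_⟩
        obtain ⟨x, hx, hyx⟩ := Set.mem_iUnion₂.1 hyS
        exact Finset.mem_image.2 ⟨x, hx, huniq Γ hΓ x _ (hpΓ x hx).1 y hyc (hpΓ x hx).2 hyx⟩
      · exact Set.indicator_of_notMem hyc _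
    rw [PointSet.pair, tsum_subtype Γ.carrier φ, tsum_eq_sum h1, Finset.sum_image hinj]
    exact Finset.sum_congr rfl fun x hx => (Set.indicator_of_mem (hpΓ x hx).1 _).symm
  rw [hpair₀]
  exact (tendsto_finsetSum S fun x hx =>
    (φ.continuous.tendsto x).comp (hlim x hx)).congr' hpair

theorem isCompact_separated {r : ℝ} (hr : 0 < r) : IsCompact (separated d r) := by
  rw [isCompact_iff_ultrafilter_le_nhds']
  exact fun 𝒰 h => exists_limit hr 𝒰 h

theorem hull_subset_separated (Λ : Delone.DeloneSet (Eu d)) :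
    hull Λ ⊆ separated d Λ.packingRadius := by
  refine closure_minimal ?_
    (isCompact_separated (NNReal.coe_pos.2 Λ.packingRadius_pos)).isClosed
  rintro _ ⟨t, rfl⟩ _ ⟨x, hx, rfl⟩ _ ⟨y, hy, rfl⟩ hne
  simp only [dist_add_left]
  exact (Λ.packingRadius_lt_dist_of_mem_ne hx hy fun h => hne (by rw [h])).le

instance (Λ : Delone.DeloneSet (Eu d)) : CompactSpace (hull Λ) :=
  isCompact_iff_compactSpace.1 <|
    (isCompact_separated (NNReal.coe_pos.2 Λ.packingRadius_pos)).of_isClosed_subset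
      isClosed_closure (hull_subset_separated Λ)

/-! ### Joint continuity of the translation action -/

theorem PointSet.pair_translate (Γ : PointSet d) (t : Eu d) (φ : C_c(Eu d, ℂ)) :
    (Γ.translate t).pair φ = ∑' x : Γ.carrier, φ (t + x) := by
  have hinj : Set.InjOn (fun x : Eu d => t + x) Γ.carrier := fun x _ y _ hxy => by simpa using hxy
  exact ((Equiv.Set.imageOfInjOn (fun x => t + x) Γ.carrier hinj).tsum_eq
    (fun x : (fun x => t + x) '' Γ.carrier => φ x)).symm

/-- The translate of a compactly supported function. -/
def translateFun (φ : C_c(Eu d, ℂ)) (t : Eu d) : C_c(Eu d, ℂ) where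
  toFun := fun x => φ (t + x)
  continuous_toFun := by fun_prop
  hasCompactSupport' := φ.hasCompactSupport.comp_homeomorph (Homeomorph.addLeft t)

/-- A bound by one fixed tent can be summed over `Γ`: pairing with the tent is vaguely continuous,
hence locally bounded in `Γ`. -/
theorem exists_norm_translateFun_sub_le (φ : C_c(Eu d, ℂ)) (t₀ : Eu d) :
    ∃ R : ℝ, ∃ hR : 0 < R, ∀ ε > 0, ∃ δ > 0, ∀ t, dist t t₀ < δ → ∀ x,
      ‖φ (t + x) - φ (t₀ + x)‖ ≤ ε * (tent (0 : Eu d) hR x).re := by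
  obtain ⟨B, hB, hφB⟩ : ∃ B > 0, ∀ x, φ x ≠ 0 → ‖x‖ ≤ B := by
    obtain ⟨B, hB⟩ := φ.hasCompactSupport.isCompact.isBounded.exists_norm_le
    exact ⟨max B 1, by positivity, fun x hx => (hB x (subset_tsupport _ hx)).trans (le_max_left _ _)⟩
  -- For `t` within 1 of `t₀`, both translates vanish outside radius `B + 1 + ‖t₀‖`; with twice that
  -- radius the tent is at least 1/2 there.
  have hR : 0 < 2 * (B + 1 + ‖t₀‖) := by positivity
  refine ⟨2 * (B + 1 + ‖t₀‖), hR, fun ε hε => ?_⟩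
  have huc : UniformContinuous φ :=
    φ.hasCompactSupport.uniformContinuous_of_continuous φ.continuous
  obtain ⟨δ, hδ, h⟩ := Metric.uniformContinuous_iff.1 huc (ε / 2) (half_pos hε)
  refine ⟨min δ 1, lt_min hδ one_pos, fun t ht x => ?_⟩
  have htent : 0 ≤ (tent (0 : Eu d) hR x).re := by simp [tent_apply]
  by_cases hx : ‖x‖ ≤ B + 1 + ‖t₀‖
  · have h1 : ‖φ (t + x) - φ (t₀ + x)‖ < ε / 2 := by
      rw [← dist_eq_norm]
      exact h (by simpa using ht.trans_le (min_le_left _ _))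
    have h2 : 1 / 2 ≤ (tent (0 : Eu d) hR x).re := by
      rw [tent_apply, Complex.ofReal_re, dist_zero_right]
      refine le_max_of_le_right ?_
      have : ‖x‖ / (2 * (B + 1 + ‖t₀‖)) ≤ 1 / 2 := by
        rw [div_le_iff₀ hR]; linarith
      linarith
    nlinarith
  · have ht1 : ‖t - t₀‖ < 1 := by
      rw [← dist_eq_norm]; exact ht.trans_le (min_le_right _ _)
    have h0 : φ (t₀ + x) = 0 := by
      by_contra hne
      have := hφB _ hne
      have h3 : ‖x‖ ≤ ‖t₀ + x‖ + ‖t₀‖ := by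
        simpa using norm_sub_le (t₀ + x) t₀
      linarith
    have h0' : φ (t + x) = 0 := by
      by_contra hne
      have := hφB _ hne
      have h3 : ‖x‖ ≤ ‖t + x‖ + ‖t‖ := by
        simpa using norm_sub_le (t + x) t
      have h4 : ‖t‖ ≤ ‖t - t₀‖ + ‖t₀‖ := by simpa using norm_add_le (t - t₀) t₀
      linarith
    rw [h0, h0', sub_zero, norm_zero]
    positivity

theorem PointSet.continuous_translate_uncurry :
    Continuous fun p : Eu d × PointSet d => p.2.translate p.1 := by
  refine continuous_induced_rng.2 (continuous_pi fun φ => ?_)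
  rw [continuous_iff_continuousAt]
  rintro ⟨t₀, Γ₀⟩
  obtain ⟨R, hR, h⟩ := exists_norm_translateFun_sub_le φ t₀
  have hM : ∀ᶠ Γ in 𝓝 Γ₀, (Γ.pair (tent 0 hR)).re < (Γ₀.pair (tent 0 hR)).re + 1 :=
    (Complex.continuous_re.comp (PointSet.continuous_pair _)).continuousAt.eventually_lt_const
      (lt_add_one _)
  set M := (Γ₀.pair (tent 0 hR)).re with hMdef
  have key : Tendsto (fun p : Eu d × PointSet d =>
      (p.2.translate p.1).pair φ - (p.2.translate t₀).pair φ) (𝓝 (t₀, Γ₀)) (𝓝 0) := by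
    rw [Metric.tendsto_nhds]
    intro ε hε
    have hpos : 0 < |M| + 2 := by positivity
    obtain ⟨δ, hδ, h'⟩ := h (ε / (|M| + 2)) (by positivity)
    rw [nhds_prod_eq]
    filter_upwards [prod_mem_prod (Metric.ball_mem_nhds t₀ hδ) hM] with ⟨t, Γ⟩ ⟨ht, hΓ⟩
    have hΓ : (Γ.pair (tent 0 hR)).re < M + 1 := hΓ
    rw [dist_zero_right, PointSet.pair_translate, PointSet.pair_translate]
    change ‖(∑' x : Γ.carrier, translateFun φ t x) - ∑' x : Γ.carrier, translateFun φ t₀ x‖ < ε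
    rw [← (Γ.summable (translateFun φ t)).tsum_sub (Γ.summable (translateFun φ t₀))]
    have hs : HasSum (fun x : Γ.carrier => ε / (|M| + 2) * (tent (0 : Eu d) hR x).re)
        (ε / (|M| + 2) * (Γ.pair (tent 0 hR)).re) :=
      (Complex.hasSum_re (Γ.summable (tent 0 hR)).hasSum).mul_left _
    refine (tsum_of_norm_bounded hs fun x => h' t ht x).trans_lt ?_
    calc ε / (|M| + 2) * (Γ.pair (tent 0 hR)).re < ε / (|M| + 2) * (|M| + 2) := by
          gcongr
          linarith [le_abs_self M]
      _ = ε := by field_simp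
  have h2 : Tendsto (fun p : Eu d × PointSet d => (p.2.translate t₀).pair φ) (𝓝 (t₀, Γ₀))
      (𝓝 ((Γ₀.translate t₀).pair φ)) :=
    (((PointSet.continuous_pair φ).comp (PointSet.continuous_translate t₀)).comp
      continuous_snd).tendsto _
  simpa [ContinuousAt] using key.add h2

theorem continuous_shift (Λ : Delone.DeloneSet (Eu d)) :
    Continuous fun p : Eu d × hull Λ => shift Λ p.1 p.2 :=
  (PointSet.continuous_translate_uncurry.comp
    (continuous_fst.prodMk (continuous_subtype_val.comp continuous_snd))).subtype_mk _

theorem shift_shift (Λ : Delone.DeloneSet (Eu d)) (s t : Eu d) (Γ : hull Λ) :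
    shift Λ s (shift Λ t Γ) = shift Λ (s + t) Γ :=
  Subtype.ext (PointSet.translate_translate s t Γ.1)

/-- A point set with the same points in a large ball around the origin has nearly the same value
under a continuous function on the hull. -/
theorem exists_dist_lt_of_inter_ball_eq {Λ : Delone.DeloneSet (Eu d)} (f : C(hull Λ, ℂ))
    {ε : ℝ} (hε : 0 < ε) :
    ∃ R : ℝ, 0 < R ∧ ∀ Γ Γ' : hull Λ,
      Γ.1.carrier ∩ Metric.ball 0 R = Γ'.1.carrier ∩ Metric.ball 0 R → dist (f Γ) (f Γ') < ε := by
  -- Otherwise pairs agreeing on ever larger balls have values `ε` apart. Along an ultrafilter both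
  -- members converge, and to the same limit, since each test function eventually sees the same
  -- points.
  by_contra! hcon
  choose a b hab hdist using fun n : ℕ => hcon (n + 1) (by positivity)
  let 𝒰 : Ultrafilter ℕ := hyperfilter ℕ
  obtain ⟨Γ, -, hΓ⟩ := isCompact_univ.ultrafilter_le_nhds (𝒰.map a) (by simp)
  obtain ⟨Γ', -, hΓ'⟩ := isCompact_univ.ultrafilter_le_nhds (𝒰.map b) (by simp)
  have hΓ : Tendsto a 𝒰 (𝓝 Γ) := hΓ
  have hΓ' : Tendsto b 𝒰 (𝓝 Γ') := hΓ'
  have heq : Γ = Γ' := by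
    refine Subtype.ext (PointSet.pair_injective (funext fun φ => ?_))
    have h1 : Tendsto (fun n => (a n).1.pair φ) 𝒰 (𝓝 (Γ.1.pair φ)) :=
      (((PointSet.continuous_pair φ).comp continuous_subtype_val).tendsto Γ).comp hΓ
    have h2 : Tendsto (fun n => (b n).1.pair φ) 𝒰 (𝓝 (Γ'.1.pair φ)) :=
      (((PointSet.continuous_pair φ).comp continuous_subtype_val).tendsto Γ').comp hΓ'
    refine tendsto_nhds_unique (h1.congr' ?_) h2
    obtain ⟨B, hB⟩ := φ.hasCompactSupport.isCompact.isBounded.exists_norm_le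
    have hev : ∀ᶠ n : ℕ in 𝒰, B < n :=
      (tendsto_natCast_atTop_atTop.eventually_gt_atTop B).filter_mono
        (Nat.hyperfilter_le_atTop)
    filter_upwards [hev] with n hn
    rw [PointSet.pair, PointSet.pair, tsum_subtype (a n).1.carrier φ,
      tsum_subtype (b n).1.carrier φ]
    refine tsum_congr fun x => ?_
    by_cases hx : φ x = 0
    · rw [Set.indicator_apply_eq_zero.2 fun _ => hx, Set.indicator_apply_eq_zero.2 fun _ => hx]
    · have hxn : x ∈ Metric.ball (0 : Eu d) (n + 1) := by
        rw [mem_ball_zero_iff]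
        linarith [hB x (subset_tsupport _ hx)]
      have hiff : x ∈ (a n).1.carrier ↔ x ∈ (b n).1.carrier := by
        simpa only [Set.mem_inter_iff, hxn, and_true] using Set.ext_iff.1 (hab n) x
      by_cases hxb : x ∈ (b n).1.carrier
      · rw [Set.indicator_of_mem hxb, Set.indicator_of_mem (hiff.2 hxb)]
      · rw [Set.indicator_of_notMem hxb, Set.indicator_of_notMem (mt hiff.1 hxb)]
  subst heq
  have hlim : Tendsto (fun n => dist (f (a n)) (f (b n))) 𝒰 (𝓝 0) := by
    simpa using ((f.continuous.tendsto Γ).comp hΓ).dist ((f.continuous.tendsto Γ).comp hΓ')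
  exact absurd (ge_of_tendsto' hlim hdist) (not_le.2 hε)

/-! ### Averages of an almost repetitive function over boxes -/

section Boxes

variable {ι : Type*}

/-- The half-open box with corners `a` and `b`. -/
def hbox (a b : ι → ℝ) : Set (ι → ℝ) := Set.univ.pi fun i => Set.Ioc (a i) (b i)

theorem mem_hbox {a b x : ι → ℝ} : x ∈ hbox a b ↔ ∀ i, a i < x i ∧ x i ≤ b i := by
  simp [hbox]

theorem hbox_subset_Icc (a b : ι → ℝ) : hbox a b ⊆ Set.Icc a b := fun _ hx =>
  ⟨fun i => (mem_hbox.1 hx i).1.le, fun i => (mem_hbox.1 hx i).2⟩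

variable [Fintype ι]

/-- The volume of the half-open box with corners `a ≤ b`. -/
def boxVol (a b : ι → ℝ) : ℝ := ∏ i, (b i - a i)

/-- The integral of `k` over the half-open box with corners `a` and `b`. -/
def boxInt (k : (ι → ℝ) → ℂ) (a b : ι → ℝ) : ℂ := ∫ x in hbox a b, k x

theorem measurableSet_hbox (a b : ι → ℝ) : MeasurableSet (hbox a b) :=
  MeasurableSet.univ_pi fun _ => measurableSet_Ioc

theorem volume_real_hbox {a b : ι → ℝ} (h : a ≤ b) : volume.real (hbox a b) = boxVol a b :=
  Real.volume_pi_Ioc_toReal h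

theorem volume_hbox_lt_top (a b : ι → ℝ) : volume (hbox a b) < ∞ :=
  (measure_mono (hbox_subset_Icc a b)).trans_lt isCompact_Icc.measure_lt_top

theorem integrableOn_hbox {k : (ι → ℝ) → ℂ} (hk : Continuous k) (a b : ι → ℝ) :
    IntegrableOn k (hbox a b) :=
  (hk.continuousOn.integrableOn_compact isCompact_Icc).mono_set (hbox_subset_Icc a b)

theorem norm_boxInt_le {k : (ι → ℝ) → ℂ} {M : ℝ} (hM : ∀ x, ‖k x‖ ≤ M) {a b : ι → ℝ}
    (h : a ≤ b) : ‖boxInt k a b‖ ≤ M * boxVol a b := by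
  rw [← volume_real_hbox h]
  exact norm_setIntegral_le_of_norm_le_const (volume_hbox_lt_top a b) fun x _ => hM x

theorem boxInt_translate (k : (ι → ℝ) → ℂ) (y a b : ι → ℝ) :
    boxInt k (y + a) (y + b) = ∫ u in hbox a b, k (y + u) := by
  have h : (fun u => y + u) ⁻¹' hbox (y + a) (y + b) = hbox a b := by
    ext u
    simp [mem_hbox]
  rw [boxInt, ← h]
  exact ((measurePreserving_add_left volume y).setIntegral_preimage_emb
    (measurableEmbedding_addLeft y) k _).symm

variable [DecidableEq ι]

theorem boxVol_split (a b : ι → ℝ) (i : ι) (c : ℝ) :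
    boxVol a b = boxVol a (Function.update b i c) + boxVol (Function.update a i c) b := by
  have h : ∀ a b : ι → ℝ, boxVol a b = (b i - a i) * ∏ j ∈ Finset.univ.erase i, (b j - a j) :=
    fun a b => (Finset.mul_prod_erase _ _ (Finset.mem_univ i)).symm
  rw [h a b, h a, h _ b]
  have h1 : ∏ j ∈ Finset.univ.erase i, (Function.update b i c j - a j) =
      ∏ j ∈ Finset.univ.erase i, (b j - a j) :=
    Finset.prod_congr rfl fun j hj => by
      rw [Function.update_of_ne (Finset.ne_of_mem_erase hj)]
  have h2 : ∏ j ∈ Finset.univ.erase i, (b j - Function.update a i c j) =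
      ∏ j ∈ Finset.univ.erase i, (b j - a j) :=
    Finset.prod_congr rfl fun j hj => by
      rw [Function.update_of_ne (Finset.ne_of_mem_erase hj)]
  rw [h1, h2, Function.update_self, Function.update_self]
  ring

theorem boxInt_split {k : (ι → ℝ) → ℂ} (hk : Continuous k) {a b : ι → ℝ} {i : ι} {c : ℝ}
    (h1 : a i ≤ c) (h2 : c ≤ b i) :
    boxInt k a b = boxInt k a (Function.update b i c) + boxInt k (Function.update a i c) b := by
  have hdisj : Disjoint (hbox a (Function.update b i c)) (hbox (Function.update a i c) b) := by
    rw [Set.disjoint_left]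
    intro x hx hx'
    have e1 := (mem_hbox.1 hx i).2
    have e2 := (mem_hbox.1 hx' i).1
    rw [Function.update_self] at e1 e2
    exact absurd e1 (not_le.2 e2)
  have hunion : hbox a b = hbox a (Function.update b i c) ∪ hbox (Function.update a i c) b := by
    ext x
    simp only [Set.mem_union, mem_hbox]
    constructor
    · intro hx
      rcases le_or_gt (x i) c with hc | hc
      · refine Or.inl fun j => ⟨(hx j).1, ?_⟩
        rcases eq_or_ne j i with rfl | hj
        · simpa using hc
        · simpa [hj] using (hx j).2
      · refine Or.inr fun j => ⟨?_, (hx j).2⟩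
        rcases eq_or_ne j i with rfl | hj
        · simpa using hc
        · simpa [hj] using (hx j).1
    · rintro (hx | hx) j
      · refine ⟨(hx j).1, ?_⟩
        have := (hx j).2
        rcases eq_or_ne j i with rfl | hj
        · rw [Function.update_self] at this; exact this.trans h2
        · rwa [Function.update_of_ne hj] at this
      · refine ⟨?_, (hx j).2⟩
        have := (hx j).1
        rcases eq_or_ne j i with rfl | hj
        · rw [Function.update_self] at this; exact h1.trans_lt this
        · rwa [Function.update_of_ne hj] at this
  rw [boxInt, hunion, setIntegral_union hdisj (measurableSet_hbox _ _)
    (integrableOn_hbox hk _ _) (integrableOn_hbox hk _ _)]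
  rfl

/-- The excess of the modulus of the integral of `k` over `β` times the volume. -/
def excess (k : (ι → ℝ) → ℂ) (β : ℝ) (a b : ι → ℝ) : ℝ := ‖boxInt k a b‖ - β * boxVol a b

theorem excess_split_le {k : (ι → ℝ) → ℂ} (hk : Continuous k) (β : ℝ) {a b : ι → ℝ} {i : ι}
    {c : ℝ} (h1 : a i ≤ c) (h2 : c ≤ b i) :
    excess k β a b ≤
      excess k β a (Function.update b i c) + excess k β (Function.update a i c) b := by
  rw [excess, excess, excess, boxInt_split hk h1 h2, boxVol_split a b i c]
  linarith [norm_add_le (boxInt k a (Function.update b i c)) (boxInt k (Function.update a i c) b)]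

/-- Boxes with long sides can be bisected into boxes of controlled shape. -/
theorem excess_nonpos_of_bisect {k : (ι → ℝ) → ℂ} (hk : Continuous k) {β L : ℝ} (hL : 0 < L)
    (h : ∀ a b : ι → ℝ, (∀ i, L ≤ b i - a i ∧ b i - a i ≤ 2 * L) → excess k β a b ≤ 0)
    (a b : ι → ℝ) (hab : ∀ i, L ≤ b i - a i) : excess k β a b ≤ 0 := by
  -- Halving a side longer than `2 * L` leaves sides longer than `L` and lowers the sum of the sides
  -- by more than `L`, so the induction ends.
  have key : ∀ n : ℕ, ∀ a b : ι → ℝ, (∀ i, L ≤ b i - a i) → ∑ i, (b i - a i) ≤ n * L →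
      excess k β a b ≤ 0 := by
    intro n
    induction n with
    | zero =>
      intro a b hab hsum
      -- All sides are positive, so a nonpositive sum means that there are no coordinates.
      refine h a b fun i => absurd hsum (not_le.2 ?_)
      have := Finset.single_le_sum (f := fun i => b i - a i)
        (fun j _ => hL.le.trans (hab j)) (Finset.mem_univ i)
      simp only [Nat.cast_zero, zero_mul]
      linarith [hab i]
    | succ n ih =>
      intro a b hab hsum
      by_cases hs : ∀ i, b i - a i ≤ 2 * L
      · exact h a b fun i => ⟨hab i, hs i⟩
      push Not at hs
      obtain ⟨i, hi⟩ := hs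
      have hsplit : ∀ a b : ι → ℝ, ∑ j, (b j - a j) =
          (b i - a i) + ∑ j ∈ Finset.univ.erase i, (b j - a j) :=
        fun a b => (Finset.add_sum_erase _ _ (Finset.mem_univ i)).symm
      rw [hsplit, Nat.cast_succ] at hsum
      set c := (a i + b i) / 2 with hc
      have e1 : excess k β a (Function.update b i c) ≤ 0 := by
        refine ih _ _ (fun j => ?_) ?_
        · rcases eq_or_ne j i with rfl | hj
          · rw [Function.update_self]; linarith
          · rw [Function.update_of_ne hj]; exact hab j
        · rw [hsplit, Finset.sum_congr rfl fun j hj => by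
            rw [Function.update_of_ne (Finset.ne_of_mem_erase hj)], Function.update_self]
          linarith
      have e2 : excess k β (Function.update a i c) b ≤ 0 := by
        refine ih _ _ (fun j => ?_) ?_
        · rcases eq_or_ne j i with rfl | hj
          · rw [Function.update_self]; linarith
          · rw [Function.update_of_ne hj]; exact hab j
        · rw [hsplit, Finset.sum_congr rfl fun j hj => by
            rw [Function.update_of_ne (Finset.ne_of_mem_erase hj)], Function.update_self]
          linarith
      have := excess_split_le hk β (a := a) (b := b) (i := i) (c := c) (by linarith) (by linarith)
      linarith
  obtain ⟨n, hn⟩ := exists_nat_ge ((∑ i, (b i - a i)) / L)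
  exact key n a b hab ((div_le_iff₀ hL).1 hn)

/-- Removing from a box everything outside an inner box. -/
theorem excess_le_of_inner {k : (ι → ℝ) → ℂ} (hk : Continuous k) {β r : ℝ} (hr : 0 ≤ r)
    (h : ∀ a b : ι → ℝ, (∀ i, r ≤ b i - a i) → excess k β a b ≤ 0) {a b a' b' : ι → ℝ}
    (ha : ∀ i, r ≤ a' i - a i) (hb : ∀ i, r ≤ b i - b' i) (hab : ∀ i, r ≤ b' i - a' i) :
    excess k β a b ≤ excess k β a' b' := by
  -- Enlarge the inner box one coordinate at a time. Each enlargement adds two slabs with all sides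
  -- at least `r`, whose excess is nonpositive.
  have key : ∀ S : Finset ι,
      excess k β (S.piecewise a a') (S.piecewise b b') ≤ excess k β a' b' := by
    intro S
    induction S using Finset.induction_on with
    | empty => simp
    | insert j S hj ih =>
      rw [Finset.piecewise_insert, Finset.piecewise_insert]
      set A := S.piecewise a a' with hA
      set B := S.piecewise b b' with hB
      have hAB : ∀ i, r ≤ B i - A i := by
        intro i
        by_cases hi : i ∈ S
        · simp only [hA, hB, Finset.piecewise_eq_of_mem _ _ _ hi]
          linarith [ha i, hb i, hab i]
        · simp only [hA, hB, Finset.piecewise_eq_of_notMem _ _ _ hi]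
          exact hab i
      have hAj : A j = a' j := Finset.piecewise_eq_of_notMem _ _ _ hj
      have hBj : B j = b' j := Finset.piecewise_eq_of_notMem _ _ _ hj
      have s1 := excess_split_le hk β (a := Function.update A j (a j))
        (b := Function.update B j (b j)) (i := j) (c := a' j)
        (by rw [Function.update_self]; linarith [ha j])
        (by rw [Function.update_self]; linarith [hb j, hab j])
      have s2 := excess_split_le hk β (a := A) (b := Function.update B j (b j)) (i := j)
        (c := b' j) (by linarith [hab j])
        (by rw [Function.update_self]; linarith [hb j])
      rw [Function.update_idem, Function.update_idem, ← hAj, Function.update_eq_self] at s1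
      rw [Function.update_idem, ← hBj, Function.update_eq_self] at s2
      have e1 : excess k β (Function.update A j (a j)) (Function.update B j (A j)) ≤ 0 := by
        refine h _ _ fun i => ?_
        rcases eq_or_ne i j with rfl | hi
        · rw [Function.update_self, Function.update_self, hAj]; exact ha i
        · rw [Function.update_of_ne hi, Function.update_of_ne hi]; exact hAB i
      have e2 : excess k β (Function.update A j (B j)) (Function.update B j (b j)) ≤ 0 := by
        refine h _ _ fun i => ?_
        rcases eq_or_ne i j with rfl | hi
        · rw [Function.update_self, Function.update_self, hBj]; exact hb i
        · rw [Function.update_of_ne hi, Function.update_of_ne hi]; exact hAB i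
      linarith
  simpa using key Finset.univ

/-- If a bounded continuous function is linearly repetitive up to small errors and unimodular
factors, then the moduli of its averages over large boxes of controlled shape converge. -/
theorem exists_tendsto_boxAverage {k : (ι → ℝ) → ℂ} (hk : Continuous k) {M : ℝ}
    (hM : ∀ x, ‖k x‖ ≤ M) {C : ℝ} (hC : 0 ≤ C)
    (hrep : ∀ ε > 0, ∃ R₀ : ℝ, ∀ R ≥ R₀, ∀ x y : ι → ℝ, ∃ v, dist v x ≤ C * R ∧
      ∃ θ : ℂ, ‖θ‖ = 1 ∧ ∀ u, ‖u‖ ≤ R → ‖k (y + u) - θ * k (v + u)‖ ≤ ε) :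
    ∃ c : ℝ, ∀ ε > 0, ∃ r₀ > 0, ∀ r ≥ r₀, ∀ a b : ι → ℝ,
      (∀ i, r ≤ b i - a i ∧ b i - a i ≤ 2 * r) →
        |‖boxInt k a b‖ - c * boxVol a b| ≤ ε * boxVol a b := by
  let G : Set ℝ := {β | ∃ r > 0, ∀ a b : ι → ℝ, (∀ i, r ≤ b i - a i) → excess k β a b ≤ 0}
  have hvol : ∀ {a b : ι → ℝ} {r : ℝ}, 0 < r → (∀ i, r ≤ b i - a i) → 0 < boxVol a b :=
    fun hr h => Finset.prod_pos fun i _ => hr.trans_le (h i)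
  have hGne : G.Nonempty := ⟨M, 1, one_pos, fun a b h => sub_nonpos.2 <|
    norm_boxInt_le hM fun i => by linarith [h i]⟩
  have hGbdd : BddBelow G := by
    refine ⟨0, fun β ⟨r, hr, h⟩ => ?_⟩
    have h1 : ∀ i : ι, r ≤ (fun _ => r : ι → ℝ) i - (0 : ι → ℝ) i := fun i => by simp
    have h2 := h 0 (fun _ => r) h1
    have h3 := hvol hr h1
    rw [excess] at h2
    by_contra! hneg
    have := mul_neg_of_neg_of_pos hneg h3
    linarith [norm_nonneg (boxInt k 0 fun _ => r)]
  set c := sInf G with hc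
  have upper : ∀ ε > 0, ∃ r > 0, ∀ a b : ι → ℝ, (∀ i, r ≤ b i - a i) →
      excess k (c + ε) a b ≤ 0 := by
    intro ε hε
    obtain ⟨β, ⟨r, hr, h⟩, hβ⟩ := exists_lt_of_csInf_lt hGne (lt_add_of_pos_right c hε)
    refine ⟨r, hr, fun a b hab => ?_⟩
    have h1 := h a b hab
    have h2 := mul_le_mul_of_nonneg_right hβ.le (hvol hr hab).le
    rw [excess] at h1 ⊢
    linarith
  have lower : ∀ δ > 0, ∃ r₀ > 0, ∀ r ≥ r₀, ∀ a b : ι → ℝ,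
      (∀ i, r ≤ b i - a i ∧ b i - a i ≤ 2 * r) → (c - δ) * boxVol a b ≤ ‖boxInt k a b‖ := by
    intro δ hδ
    -- A copy of the box has half-sides at most `r` and centre within `C * r` of the centre of the
    -- cell. A cell half-side of `(C + 2) * r` leaves a margin `r` on every side. `N` bounds the
    -- ratio of the volumes of cell and box.
    set K : ℝ := 2 * (C + 2) with hK
    have hKpos : 0 < K := by positivity
    set N : ℝ := (2 * K) ^ Fintype.card ι with hN
    have hNpos : 0 < N := by positivity
    obtain ⟨r₁, hr₁, hup⟩ := upper (δ / (8 * N)) (by positivity)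
    obtain ⟨R₀, hR₀⟩ := hrep (δ / 4) (by positivity)
    refine ⟨max r₁ R₀, lt_max_of_lt_left hr₁, fun r hr a b hab => ?_⟩
    by_contra! hlt
    have hr1 : r₁ ≤ r := (le_max_left _ _).trans hr
    have hrpos : 0 < r := hr₁.trans_le hr1
    have hLpos : 0 < K * r := by positivity
    have hQvol : r ^ Fintype.card ι ≤ boxVol a b := by
      rw [boxVol, ← Finset.card_univ, ← Finset.prod_const]
      exact Finset.prod_le_prod (fun _ _ => hrpos.le) fun i _ => (hab i).1
    have hcell : ∀ p q : ι → ℝ, (∀ i, K * r ≤ q i - p i ∧ q i - p i ≤ 2 * (K * r)) →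
        excess k (c - δ / (2 * N)) p q ≤ 0 := by
      intro p q hpq
      -- Centre and half-sides of the bad box; as the half-sides are at most `r`, repetitivity at
      -- radius `r` covers all of it.
      set y : ι → ℝ := fun i => (a i + b i) / 2 with hy
      set w : ι → ℝ := fun i => (b i - a i) / 2 with hw
      obtain ⟨v, hv, θ, hθ, hvθ⟩ := hR₀ r ((le_max_right _ _).trans hr)
        (fun i => (p i + q i) / 2) y
      have hvi : ∀ i, |v i - (p i + q i) / 2| ≤ C * r := fun i => by
        have := (dist_le_pi_dist v (fun i => (p i + q i) / 2) i).trans hv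
        rwa [Real.dist_eq] at this
      have hya : y + -w = a := by ext i; simp only [hy, hw, Pi.add_apply, Pi.neg_apply]; ring
      have hyb : y + w = b := by ext i; simp only [hy, hw, Pi.add_apply]; ring
      have hvolw : boxVol (v + -w) (v + w) = boxVol a b := by
        refine Finset.prod_congr rfl fun i _ => ?_
        simp only [hw, Pi.add_apply, Pi.neg_apply]; ring
      have hvolw' : boxVol (-w) w = boxVol a b := by
        refine Finset.prod_congr rfl fun i _ => ?_
        simp only [hw, Pi.neg_apply]; ring
      have hww : -w ≤ w := fun i => by
        simp only [hw, Pi.neg_apply]; linarith [(hab i).1]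
      have hdiff : ‖boxInt k a b - θ * boxInt k (v + -w) (v + w)‖ ≤ δ / 4 * boxVol a b := by
        rw [← hvolw', ← volume_real_hbox hww, boxInt_translate, ← hya, ← hyb, boxInt_translate,
          ← integral_const_mul, ← integral_sub]
        · refine norm_setIntegral_le_of_norm_le_const (volume_hbox_lt_top _ _) fun u hu => hvθ u ?_
          refine (pi_norm_le_iff_of_nonneg hrpos.le).2 fun i => ?_
          have := mem_hbox.1 hu i
          simp only [hw, Pi.neg_apply] at this
          rw [Real.norm_eq_abs, abs_le]
          constructor <;> linarith [(hab i).2]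
        · exact integrableOn_hbox (by fun_prop) _ _
        · exact integrableOn_hbox (by fun_prop) _ _
      have hQ' : ‖boxInt k (v + -w) (v + w)‖ ≤ (c - 3 * δ / 4) * boxVol a b := by
        have h1 : ‖θ * boxInt k (v + -w) (v + w)‖ = ‖boxInt k (v + -w) (v + w)‖ := by
          rw [norm_mul, hθ, one_mul]
        have h2 := norm_sub_norm_le (θ * boxInt k (v + -w) (v + w)) (boxInt k a b)
        rw [norm_sub_rev, h1] at h2
        linarith
      have hinner : excess k (c + δ / (8 * N)) p q ≤
          excess k (c + δ / (8 * N)) (v + -w) (v + w) := by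
        refine excess_le_of_inner hk hr₁.le hup (fun i => ?_) (fun i => ?_) fun i => ?_ <;>
        · have h1 := abs_le.1 (hvi i)
          have h2 := hab i
          have h3 := (hpq i).1
          rw [hK] at h3
          simp only [hw, Pi.add_apply, Pi.neg_apply]
          nlinarith
      have hPvol : boxVol p q ≤ N * boxVol a b := by
        calc boxVol p q ≤ ∏ _i : ι, 2 * (K * r) :=
              Finset.prod_le_prod (fun i _ => hLpos.le.trans (hpq i).1) fun i _ => (hpq i).2
          _ = N * r ^ Fintype.card ι := by
              rw [Finset.prod_const, Finset.card_univ, hN, ← mul_pow]; ring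
          _ ≤ N * boxVol a b := by gcongr
      have hP0 : 0 < boxVol p q := hvol hLpos fun i => (hpq i).1
      -- The copy saves at least `3 * δ / 4` of its volume, hence `3 * δ / (4 * N)` of the cell's.
      -- This outweighs the surplus `δ / (8 * N)` by more than `δ / (2 * N)`.
      rw [excess, excess, hvolw] at hinner
      rw [excess]
      have hQpos : 0 < boxVol a b := hvol hrpos fun i => (hab i).1
      have e1 : 0 ≤ δ / (8 * N) * boxVol a b := by positivity
      have e2 : δ / N * boxVol p q ≤ δ * boxVol a b := by
        calc δ / N * boxVol p q ≤ δ / N * (N * boxVol a b) := by gcongr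
          _ = δ * boxVol a b := by field_simp
      have e3 : δ / (8 * N) = (δ / N) / 8 := by rw [div_div, mul_comm]
      have e4 : δ / (2 * N) = (δ / N) / 2 := by rw [div_div, mul_comm]
      rw [e3] at hinner e1
      rw [e4]
      nlinarith
    have hmem : c - δ / (2 * N) ∈ G :=
      ⟨K * r, hLpos, excess_nonpos_of_bisect hk hLpos hcell⟩
    have := csInf_le hGbdd hmem
    have hpos : 0 < δ / (2 * N) := by positivity
    linarith
  refine ⟨c, fun ε hε => ?_⟩
  obtain ⟨r₁, hr₁, h1⟩ := upper ε hε
  obtain ⟨r₂, -, h2⟩ := lower ε hε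
  refine ⟨max r₁ r₂, lt_max_of_lt_left hr₁, fun r hr a b hab => ?_⟩
  have e1 := h1 a b fun i => ((le_max_left _ _).trans hr).trans (hab i).1
  have e2 := h2 r ((le_max_right _ _).trans hr) a b hab
  rw [excess] at e1
  rw [abs_le]
  constructor <;> linarith

end Boxes

section Averages

/-! ### Uniform convergence of the moduli of the averages -/

theorem norm_char (ξ t : Eu d) : ‖char ξ t‖ = 1 := by
  rw [char, mul_comm, Complex.norm_exp_ofReal_mul_I]

theorem char_add (ξ s t : Eu d) : char ξ (s + t) = char ξ s * char ξ t := by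
  rw [char, char, char, ← Complex.exp_add, inner_add_right]
  push_cast
  ring_nf

theorem continuous_char (ξ : Eu d) : Continuous (char ξ) := by
  unfold char
  fun_prop

variable {Λ : Delone.DeloneSet (Eu d)}

theorem continuous_shift_right (t : Eu d) : Continuous (shift Λ t) :=
  (continuous_shift Λ).comp (continuous_const.prodMk continuous_id)

/-- The function `Γ ↦ conj (ξ, s) f(α_{-s} Γ)`. -/
def twist (ξ : Eu d) (f : C(hull Λ, ℂ)) (s : Eu d) : C(hull Λ, ℂ) where
  toFun Γ := (starRingEnd ℂ) (char ξ s) * f (shift Λ (-s) Γ)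
  continuous_toFun := continuous_const.mul (f.continuous.comp (continuous_shift_right _))

theorem twist_apply (ξ : Eu d) (f : C(hull Λ, ℂ)) (s : Eu d) (Γ : hull Λ) :
    twist ξ f s Γ = (starRingEnd ℂ) (char ξ s) * f (shift Λ (-s) Γ) := rfl

/-- Sup-norm continuity in `s`, from joint continuity of the action. It makes averages Bochner
integrals in `C(hull Λ, ℂ)`, through which bounded operators pass. -/
theorem continuous_twist (ξ : Eu d) (f : C(hull Λ, ℂ)) : Continuous (twist ξ f) := by
  refine ContinuousMap.continuous_of_continuous_uncurry _ ?_
  refine Continuous.mul ?_ (f.continuous.comp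
    ((continuous_shift Λ).comp (f := fun p : Eu d × hull Λ => (-p.1, p.2)) ?_))
  · exact Complex.continuous_conj.comp ((continuous_char ξ).comp continuous_fst)
  · exact continuous_fst.neg.prodMk continuous_snd

theorem norm_twist_apply (ξ : Eu d) (f : C(hull Λ, ℂ)) (s : Eu d) (Γ : hull Λ) :
    ‖twist ξ f s Γ‖ = ‖f (shift Λ (-s) Γ)‖ := by
  rw [twist_apply, norm_mul, RCLike.norm_conj, norm_char, one_mul]

theorem norm_twist_le (ξ : Eu d) (f : C(hull Λ, ℂ)) (s : Eu d) : ‖twist ξ f s‖ ≤ ‖f‖ := by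
  refine (ContinuousMap.norm_le _ (norm_nonneg f)).2 fun Γ => ?_
  rw [norm_twist_apply]
  exact f.norm_coe_le_norm _

theorem twist_twist (ξ : Eu d) (f : C(hull Λ, ℂ)) (s t : Eu d) :
    twist ξ (twist ξ f t) s = twist ξ f (s + t) := by
  ext Γ
  rw [twist_apply, twist_apply, twist_apply, shift_shift, char_add, map_mul, neg_add_rev, mul_assoc]

theorem twist_shift_apply (ξ : Eu d) (f : C(hull Λ, ℂ)) (s t : Eu d) (Γ : hull Λ) :
    twist ξ f s (shift Λ t Γ) = (starRingEnd ℂ) (char ξ t) * twist ξ f (-t + s) Γ := by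
  rw [twist_apply, twist_apply, shift_shift, ← mul_assoc, ← map_mul, ← char_add, add_neg_cancel_left,
    neg_add_rev, neg_neg]

theorem integrableOn_twist (ξ : Eu d) (f : C(hull Λ, ℂ)) {Q : Set (Eu d)} (hQ : volume Q ≠ ∞) :
    IntegrableOn (twist ξ f) Q :=
  Measure.integrableOn_of_bounded hQ (continuous_twist ξ f).aestronglyMeasurable
    (Eventually.of_forall fun s => norm_twist_le ξ f s)

/-- The average over `Q` as a continuous function. -/
def averageMap (ξ : Eu d) (Q : Set (Eu d)) (f : C(hull Λ, ℂ)) : C(hull Λ, ℂ) :=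
  ((volume Q).toReal : ℂ)⁻¹ • ∫ s in Q, twist ξ f s

theorem averageMap_apply (ξ : Eu d) {Q : Set (Eu d)} (hQ : volume Q ≠ ∞) (f : C(hull Λ, ℂ))
    (Γ : hull Λ) : averageMap ξ Q f Γ = average ξ Q f Γ := by
  rw [averageMap, average, ContinuousMap.smul_apply, smul_eq_mul]
  congr 1
  exact ((ContinuousMap.evalCLM ℂ Γ).integral_comp_comm (integrableOn_twist ξ f hQ)).symm

/-- The point set `Λ` as a point of its hull. -/
def basePoint (Λ : Delone.DeloneSet (Eu d)) : hull Λ :=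
  ⟨ofDelone Λ, subset_closure ⟨0, PointSet.ext' (by simp [PointSet.translate])⟩⟩

theorem denseRange_shift_basePoint (Λ : Delone.DeloneSet (Eu d)) :
    DenseRange fun t => shift Λ t (basePoint Λ) := by
  refine Subtype.dense_iff.2 ?_
  rw [← Set.range_comp]
  exact subset_rfl

/-- Moving the centre of a patch of radius `ρ` by `w` leaves a patch of radius `ρ - ‖w‖`. One
inclusion suffices, as the roles of `z` and `z'` can be exchanged. -/
theorem translate_inter_ball_subset {A : PointSet d} {z z' w : Eu d} {ρ r : ℝ}
    (h : (fun p => -z + p) '' A.carrier ∩ Metric.ball 0 ρ ⊆ (fun p => -z' + p) '' A.carrier)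
    (hw : ‖w‖ + r ≤ ρ) :
    (A.translate (-(z + w))).carrier ∩ Metric.ball 0 r ⊆
      (A.translate (-(z' + w))).carrier ∩ Metric.ball 0 r := by
  rintro _ ⟨⟨p, hp, rfl⟩, hr⟩
  refine ⟨?_, hr⟩
  simp only [mem_ball_zero_iff] at hr
  have hmem : -z + p ∈ (fun p => -z + p) '' A.carrier ∩ Metric.ball 0 ρ := by
    refine ⟨⟨p, hp, rfl⟩, mem_ball_zero_iff.2 ?_⟩
    calc ‖-z + p‖ = ‖w + (-(z + w) + p)‖ := by congr 1; abel
      _ ≤ ‖w‖ + ‖-(z + w) + p‖ := norm_add_le _ _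
      _ < ρ := by linarith
  obtain ⟨q, hq, hqp⟩ := h hmem
  refine ⟨q, hq, ?_⟩
  simp only at hqp ⊢
  calc -(z' + w) + q = -w + (-z' + q) := by abel
    _ = -(z + w) + p := by rw [hqp]; abel

theorem norm_toLp_le (u : Fin d → ℝ) : ‖WithLp.toLp 2 u‖ ≤ (√d + 1) * ‖u‖ := by
  have h : ‖WithLp.toLp 2 u‖ ≤ √d * ‖u‖ := by
    rw [EuclideanSpace.norm_eq, ← Real.sqrt_sq (norm_nonneg u), ← Real.sqrt_mul (Nat.cast_nonneg d)]
    refine Real.sqrt_le_sqrt ?_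
    calc ∑ i, ‖u i‖ ^ 2 ≤ ∑ _i : Fin d, ‖u‖ ^ 2 := by
          gcongr with i
          exact norm_le_pi_norm u i
      _ = d * ‖u‖ ^ 2 := by simp
  nlinarith [norm_nonneg u]

theorem dist_ofLp_le (x y : Eu d) : dist x.ofLp y.ofLp ≤ dist x y := by
  refine (dist_pi_le_iff dist_nonneg).2 fun i => ?_
  rw [Real.dist_eq, dist_eq_norm]
  simpa using PiLp.norm_apply_le (x - y) i

/-- The function `x ↦ conj (ξ, x) f(α_{-x} Λ)` in coordinates. -/
def orbitFun (ξ : Eu d) (f : C(hull Λ, ℂ)) (x : Fin d → ℝ) : ℂ :=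
  twist ξ f (WithLp.toLp 2 x) (basePoint Λ)

theorem continuous_orbitFun (ξ : Eu d) (f : C(hull Λ, ℂ)) : Continuous (orbitFun ξ f) :=
  (continuous_eval_const (basePoint Λ)).comp
    ((continuous_twist ξ f).comp (PiLp.continuous_toLp 2 _))

theorem norm_orbitFun_le (ξ : Eu d) (f : C(hull Λ, ℂ)) (x : Fin d → ℝ) :
    ‖orbitFun ξ f x‖ ≤ ‖f‖ :=
  (ContinuousMap.norm_coe_le_norm _ _).trans (norm_twist_le ξ f _)

theorem orbitFun_repetitive (hΛ : LinearlyRepetitive Λ) (ξ : Eu d) (f : C(hull Λ, ℂ)) :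
    ∃ C : ℝ, 0 ≤ C ∧ ∀ ε > 0, ∃ R₀ : ℝ, ∀ R ≥ R₀, ∀ x y : Fin d → ℝ, ∃ v, dist v x ≤ C * R ∧
      ∃ θ : ℂ, ‖θ‖ = 1 ∧ ∀ u, ‖u‖ ≤ R →
        ‖orbitFun ξ f (y + u) - θ * orbitFun ξ f (v + u)‖ ≤ ε := by
  obtain ⟨C, hC, hrep⟩ := hΛ
  refine ⟨C * (√d + 2), by positivity, fun ε hε => ?_⟩
  obtain ⟨R₁, hR₁, hf⟩ := exists_dist_lt_of_inter_ball_eq f hε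
  refine ⟨max 1 (Λ.coveringRadius + R₁), fun R hR x y => ?_⟩
  have hR1 : 1 ≤ R := (le_max_left _ _).trans hR
  have hR2 : Λ.coveringRadius + R₁ ≤ R := (le_max_right _ _).trans hR
  have hcov : (0 : ℝ) ≤ Λ.coveringRadius := Λ.coveringRadius.2
  set X : Eu d := WithLp.toLp 2 x
  set Y : Eu d := WithLp.toLp 2 y
  obtain ⟨p, hp, hYp⟩ := Λ.exists_dist_le_coveringRadius Y
  -- The patch around `p` must contain the `R₁`-balls around all `Y + U`: `U` has Euclidean norm at
  -- most `(√d + 1) * R`, and `p` is within the covering radius of `Y`. The `+ 1` ensures `1 ≤ ρ`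
  -- also for `d = 0`.
  set ρ : ℝ := (√d + 1) * R + (Λ.coveringRadius + R₁) with hρ
  have hρ1 : 1 ≤ ρ := by nlinarith [Real.sqrt_nonneg d]
  obtain ⟨z, hz, hzX, hpatch⟩ := hrep ρ hρ1 (X + (p - Y)) p hp
  -- `V` lies relative to `z` as `Y` does relative to `p`; aiming `z` at `X + (p - Y)` puts `V` near
  -- `X`. The phase compares the characters at `Y` and `V`.
  set V : Eu d := z + (Y - p) with hV
  refine ⟨V.ofLp, ?_, (starRingEnd ℂ) (char ξ (Y - V)), ?_, fun u hu => ?_⟩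
  · calc dist V.ofLp x ≤ dist V X := dist_ofLp_le V X
      _ = dist z (X + (p - Y)) := by
          rw [dist_eq_norm, dist_eq_norm, hV]; congr 1; abel
      _ ≤ ρ * C := (Metric.mem_ball.1 hzX).le
      _ ≤ C * (√d + 2) * R := by nlinarith
  · rw [RCLike.norm_conj, norm_char]
  · set U : Eu d := WithLp.toLp 2 u with hU
    have hw : ‖(Y - p) + U‖ + R₁ ≤ ρ := by
      have h1 := norm_add_le (Y - p) U
      have h2 : ‖U‖ ≤ (√d + 1) * R :=
        (norm_toLp_le u).trans (mul_le_mul_of_nonneg_left hu (by positivity))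
      rw [dist_eq_norm] at hYp
      linarith
    have e1 : p + ((Y - p) + U) = Y + U := by abel
    have e2 : z + ((Y - p) + U) = V + U := by rw [hV]; abel
    have hagree : (shift Λ (-(Y + U)) (basePoint Λ)).1.carrier ∩ Metric.ball 0 R₁ =
        (shift Λ (-(V + U)) (basePoint Λ)).1.carrier ∩ Metric.ball 0 R₁ := by
      have h1 := translate_inter_ball_subset (A := ofDelone Λ) (z := p) (z' := z)
        (hpatch.symm.subset.trans Set.inter_subset_left) hw
      have h2 := translate_inter_ball_subset (A := ofDelone Λ) (z := z) (z' := p)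
        (hpatch.subset.trans Set.inter_subset_left) hw
      rw [e1, e2] at h1 h2
      exact h1.antisymm h2
    have hYU : orbitFun ξ f (y + u) = twist ξ f (Y + U) (basePoint Λ) := rfl
    have hVU : orbitFun ξ f (V.ofLp + u) = twist ξ f (V + U) (basePoint Λ) := rfl
    rw [hYU, hVU, twist_apply, twist_apply, ← mul_assoc, ← map_mul, ← char_add,
      show Y - V + (V + U) = Y + U by abel, ← mul_sub, norm_mul, RCLike.norm_conj, norm_char,
      one_mul, ← dist_eq_norm]
    exact (hf _ _ hagree).le

/-! ### From Euclidean boxes to half-open coordinate boxes -/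

theorem ae_eq_Ioc_of_ordConnected {I : Set ℝ} (hne : I.Nonempty) (hI : I.OrdConnected)
    (hb : Bornology.IsBounded I) : I =ᵐ[volume] Set.Ioc (sInf I) (sSup I) := by
  have h1 : Set.Ioo (sInf I) (sSup I) ⊆ I := by
    rintro x ⟨hx1, hx2⟩
    obtain ⟨a, ha, hax⟩ := exists_lt_of_csInf_lt hne hx1
    obtain ⟨b, hb, hxb⟩ := exists_lt_of_lt_csSup hne hx2
    exact hI.out ha hb ⟨hax.le, hxb.le⟩
  have h2 : I ⊆ Set.Icc (sInf I) (sSup I) := fun x hx =>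
    ⟨csInf_le hb.bddBelow hx, le_csSup hb.bddAbove hx⟩
  have h3 : Set.Icc (sInf I) (sSup I) ≤ᵐ[volume] I :=
    (Ioo_ae_eq_Icc (μ := volume)).symm.le.trans h1.eventuallyLE
  exact (h2.eventuallyLE.antisymm h3).trans Ioc_ae_eq_Icc.symm

/-- A box agrees up to a null set with a half-open box. -/
theorem exists_hbox_of_mem_boxes {r : ℝ} {Q : Set (Eu d)} (hQ : Q ∈ boxes d r) :
    ∃ a b : Fin d → ℝ, (∀ i, r ≤ b i - a i ∧ b i - a i ≤ 2 * r) ∧ a ≤ b ∧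
      Q =ᵐ[volume] WithLp.ofLp ⁻¹' hbox a b := by
  obtain ⟨I, hI, rfl⟩ := hQ
  refine ⟨fun i => sInf (I i), fun i => sSup (I i), fun i => ?_, fun i => ?_, ?_⟩
  · rw [← Real.diam_eq (hI i).2.2.1]
    exact (hI i).2.2.2
  · exact csInf_le_csSup (hI i).1 (hI i).2.2.1.bddBelow (hI i).2.2.1.bddAbove
  · have h : (Set.univ.pi I : Set (Fin d → ℝ)) =ᵐ[volume]
        hbox (fun i => sInf (I i)) fun i => sSup (I i) :=
      Measure.ae_eq_set_pi fun i _ => ae_eq_Ioc_of_ordConnected (hI i).1 (hI i).2.1 (hI i).2.2.1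
    have h' := (PiLp.volume_preserving_ofLp (Fin d)).quasiMeasurePreserving.preimage_ae_eq h
    have e : {x : Eu d | ∀ j, x j ∈ I j} = WithLp.ofLp ⁻¹' (Set.univ.pi I) := by
      ext x; simp
    rw [e]
    exact h'

theorem setIntegral_preimage_ofLp {E : Type*} [NormedAddCommGroup E] [NormedSpace ℝ E]
    (g : Eu d → E) (S : Set (Fin d → ℝ)) :
    ∫ s in WithLp.ofLp ⁻¹' S, g s = ∫ x in S, g (WithLp.toLp 2 x) :=
  (PiLp.volume_preserving_ofLp (Fin d)).setIntegral_preimage_emb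
    (MeasurableEquiv.toLp 2 (Fin d → ℝ)).symm.measurableEmbedding
    (fun x => g (WithLp.toLp 2 x)) S

theorem volume_preimage_hbox (a b : Fin d → ℝ) :
    volume ((WithLp.ofLp : Eu d → Fin d → ℝ) ⁻¹' hbox a b) = volume (hbox a b) :=
  (PiLp.volume_preserving_ofLp (Fin d)).measure_preimage (measurableSet_hbox a b).nullMeasurableSet

theorem volume_ne_top_of_mem_boxes {r : ℝ} {Q : Set (Eu d)} (hQ : Q ∈ boxes d r) :
    volume Q ≠ ∞ := by
  obtain ⟨a, b, -, -, h⟩ := exists_hbox_of_mem_boxes hQ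
  rw [measure_congr h, volume_preimage_hbox]
  exact (volume_hbox_lt_top a b).ne

theorem norm_average_shift (ξ : Eu d) (f : C(hull Λ, ℂ)) {Q : Set (Eu d)} {a b : Fin d → ℝ}
    (hab : a ≤ b) (hQ : Q =ᵐ[volume] WithLp.ofLp ⁻¹' hbox a b) (t : Eu d) :
    ‖average ξ Q f (shift Λ t (basePoint Λ))‖ =
      (boxVol a b)⁻¹ * ‖boxInt (orbitFun ξ f) (-t.ofLp + a) (-t.ofLp + b)‖ := by
  have h1 : (volume Q).toReal = boxVol a b := by
    rw [measure_congr hQ, volume_preimage_hbox, ← volume_real_hbox hab]; rfl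
  have h0 : 0 ≤ boxVol a b := by rw [← h1]; exact ENNReal.toReal_nonneg
  have h2 : ∫ s in Q, (starRingEnd ℂ) (char ξ s) * f (shift Λ (-s) (shift Λ t (basePoint Λ))) =
      (starRingEnd ℂ) (char ξ t) * boxInt (orbitFun ξ f) (-t.ofLp + a) (-t.ofLp + b) := by
    calc _ = ∫ s in WithLp.ofLp ⁻¹' hbox a b, twist ξ f s (shift Λ t (basePoint Λ)) :=
          setIntegral_congr_set hQ
      _ = ∫ s in WithLp.ofLp ⁻¹' hbox a b,
            (starRingEnd ℂ) (char ξ t) * twist ξ f (-t + s) (basePoint Λ) := by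
          simp only [twist_shift_apply]
      _ = _ := by
          rw [integral_const_mul, setIntegral_preimage_ofLp, boxInt_translate]; rfl
  rw [average, h1, h2, norm_mul, norm_mul, RCLike.norm_conj, norm_char, one_mul, norm_inv,
    Complex.norm_real, Real.norm_of_nonneg h0]

theorem exists_tendstoUniformly_norm_average (hΛ : LinearlyRepetitive Λ) (f : C(hull Λ, ℂ))
    (ξ : Eu d) :
    ∃ c : ℝ, ∀ (r : ℕ → ℝ) (Q : ℕ → Set (Eu d)), Tendsto r atTop atTop →
      (∀ n, Q n ∈ boxes d (r n)) →
        TendstoUniformly (fun n Γ => ‖average ξ (Q n) f Γ‖) (fun _ => c) atTop := by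
  obtain ⟨C, hC, hrep⟩ := orbitFun_repetitive hΛ ξ f
  obtain ⟨c, hc⟩ := exists_tendsto_boxAverage (continuous_orbitFun ξ f) (norm_orbitFun_le ξ f)
    hC hrep
  refine ⟨c, fun r Q hr hQ => ?_⟩
  rw [Metric.tendstoUniformly_iff]
  intro ε hε
  obtain ⟨r₀, hr₀, h⟩ := hc (ε / 2) (half_pos hε)
  filter_upwards [hr.eventually_ge_atTop r₀] with n hn Γ
  obtain ⟨a, b, hside, hab, hae⟩ := exists_hbox_of_mem_boxes (hQ n)
  refine lt_of_le_of_lt ?_ (half_lt_self hε)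
  have hcont : Continuous fun Γ => dist c ‖average ξ (Q n) f Γ‖ := by
    simp only [← averageMap_apply ξ (volume_ne_top_of_mem_boxes (hQ n)) f]
    fun_prop
  -- A non-strict bound is a closed condition, so it suffices to check it on the dense orbit, where
  -- it is the position-independent box estimate.
  refine (denseRange_shift_basePoint Λ).induction_on
    (p := fun Γ => dist c ‖average ξ (Q n) f Γ‖ ≤ ε / 2) Γ
    (isClosed_le hcont continuous_const) fun t => ?_
  have hvol : boxVol (-t.ofLp + a) (-t.ofLp + b) = boxVol a b := by simp [boxVol]
  have hpos : 0 < boxVol a b :=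
    Finset.prod_pos fun i _ => (hr₀.trans_le hn).trans_le (hside i).1
  have h1 := h (r n) hn (-t.ofLp + a) (-t.ofLp + b) fun i => by simpa using hside i
  rw [hvol] at h1
  rw [norm_average_shift ξ f hab hae, dist_comm, Real.dist_eq]
  rw [show (boxVol a b)⁻¹ * ‖boxInt (orbitFun ξ f) (-t.ofLp + a) (-t.ofLp + b)‖ - c =
    (boxVol a b)⁻¹ * (‖boxInt (orbitFun ξ f) (-t.ofLp + a) (-t.ofLp + b)‖ - c * boxVol a b) by
      field_simp, abs_mul, abs_of_pos (inv_pos.2 hpos), inv_mul_le_iff₀ hpos, mul_comm (boxVol a b) (ε / 2)]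
  exact h1

end Averages

/-! ### Projections onto invariant vectors -/

section Hilbert

variable {H : Type*} [NormedAddCommGroup H] [InnerProductSpace ℂ H]

theorem inner_eq_of_forall_map_eq (U : H →ₗᵢ[ℂ] H) {v : H} (hv : U v = v) (f : H) :
    inner ℂ v (U f) = inner ℂ v f := by
  conv_lhs => rw [← hv]
  exact U.inner_map_map v f

/-- The projection onto the invariant vectors is the element of minimal norm in the closed convex
hull of the orbit. -/
theorem starProjection_mem_closure_of_convex [CompleteSpace H] {G : Type*} [AddGroup G]
    (U : G → H →ₗᵢ[ℂ] H)
    (V : Submodule ℂ H) [V.HasOrthogonalProjection] (hV : ∀ g, g ∈ V ↔ ∀ t, U t g = g) {f : H}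
    (hU : ∀ s t, U s (U t f) = U (s + t) f) {S : Set H} (hS : ∀ t, U t f ∈ S)
    (hconv : ∀ x ∈ S, ∀ y ∈ S, ∀ a b : ℝ, 0 ≤ a → 0 ≤ b → a + b = 1 →
      (a : ℂ) • x + (b : ℂ) • y ∈ S) :
    V.starProjection f ∈ closure S := by
  let : InnerProductSpace ℝ H := InnerProductSpace.complexToReal
  have hSconv : Convex ℝ S := fun x hx y hy a b ha hb hab => by
    simpa only [Complex.coe_smul] using hconv x hx y hy a b ha hb hab
  set O : Set H := Set.range fun t => U t f with hO
  set K : Set H := closure (convexHull ℝ O) with hK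
  have hmin : ∀ A : Set H, IsClosed A → Convex ℝ A → O ⊆ A → K ⊆ A := fun A h1 h2 h3 =>
    closure_minimal (convexHull_min h3 h2) h1
  have hOK : O ⊆ K := (subset_convexHull ℝ O).trans subset_closure
  have hKc : Convex ℝ K := (convex_convexHull ℝ O).closure
  have hKS : K ⊆ closure S := hmin _ isClosed_closure hSconv.closure
    ((Set.range_subset_iff.2 hS).trans subset_closure)
  obtain ⟨h, hhK, hh⟩ := exists_norm_eq_iInf_of_complete_convex
    (⟨_, hOK ⟨0, rfl⟩⟩ : K.Nonempty) isClosed_closure.isComplete hKc 0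
  have hle := (norm_eq_iInf_iff_real_inner_le_zero hKc hhK).1 hh
  have hUK : ∀ t, ∀ w ∈ K, U t w ∈ K := fun t w hw => by
    refine hmin ((U t) ⁻¹' K) (isClosed_closure.preimage (U t).continuous)
      (hKc.linear_preimage ((U t).toLinearMap.restrictScalars ℝ)) ?_ hw
    rintro _ ⟨s, rfl⟩
    exact hOK ⟨t + s, (hU t s).symm⟩
  -- `U t h` lies in `K` and has the same minimal norm as `h`, so the variational inequality forces
  -- them to be equal.
  have hfix : h ∈ V := (hV h).2 fun t => by
    have h1 := hle _ (hUK t h hhK)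
    rw [zero_sub, inner_neg_left, inner_sub_right, real_inner_self_eq_norm_sq] at h1
    have h2 := norm_sub_sq_real h (U t h)
    rw [(U t).norm_map] at h2
    have h3 : ‖h - U t h‖ ^ 2 ≤ 0 := by linarith
    have h4 : ‖h - U t h‖ = 0 := pow_eq_zero_iff two_ne_zero |>.1 (h3.antisymm (sq_nonneg _))
    exact (sub_eq_zero.1 (norm_eq_zero.1 h4)).symm
  -- Pairing with a fixed vector is constant on the orbit, hence on its closed convex hull.
  have hinner : ∀ v ∈ V, inner ℂ v h = inner ℂ v f := fun v hv => by
    refine hmin {w | inner ℂ v w = inner ℂ v f}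
      (isClosed_eq (by fun_prop) continuous_const) ?_ ?_ hhK
    · intro x hx y hy a b _ _ hab
      change inner ℂ v (a • x + b • y) = inner ℂ v f
      rw [← Complex.coe_smul, ← Complex.coe_smul, inner_add_right, inner_smul_right,
        inner_smul_right, hx, hy, ← add_mul, ← Complex.ofReal_add, hab, Complex.ofReal_one, one_mul]
    · rintro _ ⟨t, rfl⟩
      exact inner_eq_of_forall_map_eq (U t) ((hV v).1 hv t) f
  have hproj : V.starProjection f = h := by
    refine V.eq_starProjection_of_mem_of_inner_eq_zero hfix fun w hw => ?_
    rw [inner_eq_zero_symm, inner_sub_right, hinner w hw, sub_self]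
  rw [hproj]
  exact hKS hhK

end Hilbert

/-! ### Translations of large cubes -/

/-- The half-open cube of side length `2 ρ` centred at the origin. -/
def cube (d : ℕ) (ρ : ℝ) : Set (Eu d) := WithLp.ofLp ⁻¹' hbox (fun _ => -ρ) fun _ => ρ

theorem mem_cube {ρ : ℝ} {x : Eu d} : x ∈ cube d ρ ↔ ∀ j, -ρ < x j ∧ x j ≤ ρ := mem_hbox

theorem measurableSet_cube (ρ : ℝ) : MeasurableSet (cube d ρ) :=
  (PiLp.volume_preserving_ofLp (Fin d)).measurable (measurableSet_hbox _ _)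

theorem volume_cube_ne_top (ρ : ℝ) : volume (cube d ρ) ≠ ∞ := by
  rw [cube, volume_preimage_hbox]
  exact (volume_hbox_lt_top _ _).ne

theorem volume_real_cube {ρ : ℝ} (hρ : 0 ≤ ρ) : volume.real (cube d ρ) = (2 * ρ) ^ d := by
  rw [Measure.real, cube, volume_preimage_hbox]
  refine (volume_real_hbox fun _ => by simpa using hρ).trans ?_
  simp [boxVol, two_mul]

theorem cube_mem_boxes {ρ : ℝ} (hρ : 0 < ρ) : cube d ρ ∈ boxes d (2 * ρ) := by
  refine ⟨fun _ => Set.Ioc (-ρ) ρ, fun j => ⟨Set.nonempty_Ioc.2 (by linarith),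
    Set.ordConnected_Ioc, Metric.isBounded_Ioc _ _, ?_⟩, ?_⟩
  · rw [Real.diam_Ioc (by linarith)]
    constructor <;> linarith
  · ext x
    exact mem_cube

theorem norm_setIntegral_sub_le {α E : Type*} [MeasurableSpace α] {μ : Measure α}
    [NormedAddCommGroup E] [NormedSpace ℝ E] {F : α → E} {M : ℝ} (hM : ∀ s, ‖F s‖ ≤ M)
    {A B : Set α} (hAB : A ⊆ B) (hA : MeasurableSet A) (hμ : μ B ≠ ∞)
    (hF : IntegrableOn F B μ) :
    ‖∫ s in B, F s ∂μ - ∫ s in A, F s ∂μ‖ ≤ M * (μ.real B - μ.real A) := by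
  rw [← setIntegral_sdiff hA hF hAB, ← measureReal_sdiff hAB hA hμ]
  exact norm_setIntegral_le_of_norm_le_const
    ((measure_mono Set.sdiff_subset).trans_lt hμ.lt_top) fun s _ => hM s

/-- The cube and its translate both lie in the cube of half-side `ρ + ‖t‖`; each differs from it by
a set of the same small volume. -/
theorem norm_cube_translate_sub_le {E : Type*} [NormedAddCommGroup E] [NormedSpace ℝ E]
    {F : Eu d → E} (hF : Continuous F) {M : ℝ} (hM : ∀ s, ‖F s‖ ≤ M) (t : Eu d) {ρ : ℝ}
    (hρ : 0 ≤ ρ) :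
    ‖(∫ s in cube d ρ, F (s + t)) - ∫ s in cube d ρ, F s‖ ≤
      2 * M * ((2 * (ρ + ‖t‖)) ^ d - (2 * ρ) ^ d) := by
  set B := cube d (ρ + ‖t‖) with hB
  set A := (fun s => s + -t) ⁻¹' cube d ρ with hA
  have ht : ∀ j, |t j| ≤ ‖t‖ := fun j => PiLp.norm_apply_le t j
  have h1 : cube d ρ ⊆ B := fun s hs => mem_cube.2 fun j => by
    have := mem_cube.1 hs j
    constructor <;> linarith [norm_nonneg t]
  have h2 : A ⊆ B := fun s hs => mem_cube.2 fun j => by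
    have h3 := mem_cube.1 hs j
    have h4 := abs_le.1 (ht j)
    simp only [PiLp.add_apply, PiLp.neg_apply] at h3
    constructor <;> linarith
  have hAm : MeasurableSet A := (measurable_add_const _) (measurableSet_cube ρ)
  have hFB : IntegrableOn F B := Measure.integrableOn_of_bounded (volume_cube_ne_top _)
    hF.aestronglyMeasurable (Eventually.of_forall hM)
  have hint : ∫ s in cube d ρ, F (s + t) = ∫ s in A, F s := by
    have : (fun s => s + t) ⁻¹' A = cube d ρ := by
      ext s
      simp [hA]
    rw [← this]
    exact (measurePreserving_add_right volume t).setIntegral_preimage_emb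
      (measurableEmbedding_addRight t) F A
  have hvA : volume.real A = (2 * ρ) ^ d := by
    rw [← volume_real_cube hρ, Measure.real, Measure.real, hA, measure_preimage_add_right]
  have hvB : volume.real B = (2 * (ρ + ‖t‖)) ^ d := volume_real_cube (by positivity)
  have e1 := norm_setIntegral_sub_le hM h1 (measurableSet_cube ρ) (volume_cube_ne_top _) hFB
  have e2 := norm_setIntegral_sub_le hM h2 hAm (volume_cube_ne_top _) hFB
  rw [hvB, volume_real_cube hρ] at e1
  rw [hvB, hvA] at e2
  rw [hint]
  calc _ = ‖((∫ s in B, F s) - ∫ s in cube d ρ, F s) - ((∫ s in B, F s) - ∫ s in A, F s)‖ := by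
        congr 1; abel
    _ ≤ _ := (norm_sub_le _ _).trans (by linarith)

theorem tendsto_cube_translate {E : Type*} [NormedAddCommGroup E] [NormedSpace ℝ E]
    {F : Eu d → E} (hF : Continuous F) {M : ℝ} (hM : ∀ s, ‖F s‖ ≤ M) (t : Eu d) :
    Tendsto (fun n : ℕ => (volume.real (cube d (n + 1)))⁻¹ •
      ((∫ s in cube d (n + 1), F (s + t)) - ∫ s in cube d (n + 1), F s)) atTop (𝓝 0) := by
  have hlim : Tendsto (fun n : ℕ => 2 * M * ((1 + ‖t‖ * (1 / ((n : ℝ) + 1))) ^ d - 1)) atTop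
      (𝓝 (2 * M * ((1 + ‖t‖ * 0) ^ d - 1))) :=
    (((tendsto_one_div_add_atTop_nhds_zero_nat.const_mul ‖t‖).const_add 1).pow d
      |>.sub_const 1).const_mul (2 * M)
  rw [mul_zero, add_zero, one_pow, sub_self, mul_zero] at hlim
  refine squeeze_zero_norm (fun n => ?_) hlim
  have hn : (0 : ℝ) < n + 1 := by positivity
  rw [norm_smul, volume_real_cube hn.le, norm_inv, Real.norm_of_nonneg (by positivity),
    inv_mul_le_iff₀ (by positivity)]
  refine (norm_cube_translate_sub_le hF hM t hn.le).trans_eq ?_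
  have : 2 * ((n : ℝ) + 1 + ‖t‖) = 2 * (n + 1) * (1 + ‖t‖ * (1 / ((n : ℝ) + 1))) := by
    field_simp
  rw [this, mul_pow]
  ring

/-! ### The mean ergodic theorem for continuous functions on the hull -/

section Ergodic

variable {Λ : Delone.DeloneSet (Eu d)} {m : Measure (hull Λ)}

theorem star_char_mul_char (ξ t : Eu d) : (starRingEnd ℂ) (char ξ t) * char ξ t = 1 := by
  rw [← Complex.normSq_eq_conj_mul_self, Complex.normSq_eq_norm_sq, norm_char]
  simp

/-- The isometry `g ↦ conj (ξ, t) T_t g`. -/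
def twistedKoopman (hm : ∀ t, MeasurePreserving (shift Λ t) m m) (ξ t : Eu d) :
    Lp ℂ 2 m →ₗᵢ[ℂ] Lp ℂ 2 m where
  toLinearMap := (starRingEnd ℂ) (char ξ t) • (koopman hm t).toLinearMap
  norm_map' g := by
    change ‖(starRingEnd ℂ) (char ξ t) • koopman hm t g‖ = ‖g‖
    rw [norm_smul, RCLike.norm_conj, norm_char, one_mul, LinearIsometry.norm_map]

theorem twistedKoopman_apply (hm : ∀ t, MeasurePreserving (shift Λ t) m m) (ξ t : Eu d)
    (g : Lp ℂ 2 m) : twistedKoopman hm ξ t g = (starRingEnd ℂ) (char ξ t) • koopman hm t g := rfl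

theorem mem_eigenspace_iff (hm : ∀ t, MeasurePreserving (shift Λ t) m m) (ξ : Eu d)
    (g : Lp ℂ 2 m) : g ∈ (eigenspace hm ξ).toSubmodule ↔ ∀ t, koopman hm t g = char ξ t • g :=
  Iff.rfl

theorem mem_eigenspace_iff_twistedKoopman (hm : ∀ t, MeasurePreserving (shift Λ t) m m)
    (ξ : Eu d) (g : Lp ℂ 2 m) :
    g ∈ (eigenspace hm ξ).toSubmodule ↔ ∀ t, twistedKoopman hm ξ t g = g := by
  rw [mem_eigenspace_iff]
  refine forall_congr' fun t => ?_
  rw [twistedKoopman_apply]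
  constructor
  · intro h
    rw [h, smul_smul, star_char_mul_char, one_smul]
  · intro h
    conv_rhs => rw [← h, smul_smul, mul_comm, star_char_mul_char, one_smul]

theorem starProjection_twistedKoopman (hm : ∀ t, MeasurePreserving (shift Λ t) m m) (ξ t : Eu d)
    (g : Lp ℂ 2 m) :
    (eigenspace hm ξ).toSubmodule.starProjection (twistedKoopman hm ξ t g) =
      (eigenspace hm ξ).toSubmodule.starProjection g := by
  rw [← sub_eq_zero, ← map_sub, Submodule.starProjection_apply_eq_zero_iff,
    Submodule.mem_orthogonal]
  intro v hv
  rw [inner_sub_right, inner_eq_of_forall_map_eq _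
    ((mem_eigenspace_iff_twistedKoopman hm ξ v).1 hv t), sub_self]

variable [IsProbabilityMeasure m]

theorem twistedKoopman_toLp (hm : ∀ t, MeasurePreserving (shift Λ t) m m) (ξ t : Eu d)
    (f : C(hull Λ, ℂ)) :
    twistedKoopman hm ξ t (ContinuousMap.toLp 2 m ℂ f) =
      ContinuousMap.toLp 2 m ℂ (twist ξ f t) := by
  rw [twistedKoopman_apply]
  refine Lp.ext ?_
  have h1 : koopman hm t (ContinuousMap.toLp 2 m ℂ f) =ᵐ[m]
      (ContinuousMap.toLp 2 m ℂ f : hull Λ → ℂ) ∘ shift Λ (-t) :=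
    Lp.coeFn_compMeasurePreserving _ (hm (-t))
  have h2 : (ContinuousMap.toLp 2 m ℂ f : hull Λ → ℂ) ∘ shift Λ (-t) =ᵐ[m]
      f ∘ shift Λ (-t) :=
    (hm (-t)).quasiMeasurePreserving.ae_eq_comp (ContinuousMap.coeFn_toLp m f)
  filter_upwards [Lp.coeFn_smul ((starRingEnd ℂ) (char ξ t))
    (koopman hm t (ContinuousMap.toLp 2 m ℂ f)), h1, h2,
    ContinuousMap.coeFn_toLp (p := 2) (𝕜 := ℂ) m (twist ξ f t)] with Γ e1 e2 e3 e4
  rw [e1, e4, Pi.smul_apply, e2, e3, twist_apply, smul_eq_mul, Function.comp_apply]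

theorem norm_averageMap_le (ξ : Eu d) {Q : Set (Eu d)} (hQ : volume Q ≠ ∞) (f : C(hull Λ, ℂ)) :
    ‖averageMap ξ Q f‖ ≤ ‖f‖ := by
  have h := norm_setIntegral_le_of_norm_le_const (f := twist ξ f) hQ.lt_top
    fun s _ => norm_twist_le ξ f s
  rw [averageMap, norm_smul, norm_inv, Complex.norm_real,
    Real.norm_of_nonneg ENNReal.toReal_nonneg]
  -- Over a null set the average is 0, as the inverse of 0 is 0.
  rcases eq_or_lt_of_le (ENNReal.toReal_nonneg (a := volume Q)) with h0 | h0
  · rw [← h0, inv_zero, zero_mul]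
    exact norm_nonneg f
  · rw [inv_mul_le_iff₀ h0, mul_comm]
    exact h

theorem averageMap_add_smul (ξ : Eu d) {Q : Set (Eu d)} (hQ : volume Q ≠ ∞)
    (f g : C(hull Λ, ℂ)) (a b : ℂ) :
    averageMap ξ Q (a • f + b • g) = a • averageMap ξ Q f + b • averageMap ξ Q g := by
  have h : twist ξ (a • f + b • g) = fun s => a • twist ξ f s + b • twist ξ g s := by
    ext s Γ
    simp only [twist_apply, ContinuousMap.add_apply, ContinuousMap.smul_apply, smul_eq_mul]
    ring
  rw [averageMap, h, integral_add (f := fun s => a • twist ξ f s) (g := fun s => b • twist ξ g s)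
    ((integrableOn_twist ξ f hQ).smul a)
    ((integrableOn_twist ξ g hQ).smul b), integral_smul, integral_smul, averageMap, averageMap,
    smul_add, smul_comm a, smul_comm b]

/-- Stated for any bounded `P` so as to serve both the identity and the eigenspace projection. -/
theorem toLp_averageMap (hm : ∀ t, MeasurePreserving (shift Λ t) m m) (ξ : Eu d)
    {Q : Set (Eu d)} (hQ : volume Q ≠ ∞) (f : C(hull Λ, ℂ)) {E : Type*} [NormedAddCommGroup E]
    [NormedSpace ℂ E] [CompleteSpace E] (P : Lp ℂ 2 m →L[ℂ] E) :
    P (ContinuousMap.toLp 2 m ℂ (averageMap ξ Q f)) =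
      ((volume Q).toReal : ℂ)⁻¹ •
        ∫ s in Q, P (twistedKoopman hm ξ s (ContinuousMap.toLp 2 m ℂ f)) := by
  simp only [twistedKoopman_toLp]
  rw [averageMap, map_smul, map_smul]
  congr 1
  exact ((P.comp (ContinuousMap.toLp 2 m ℂ)).integral_comp_comm (integrableOn_twist ξ f hQ)).symm

theorem norm_toLp_averageMap_le (hm : ∀ t, MeasurePreserving (shift Λ t) m m) (ξ : Eu d)
    {Q : Set (Eu d)} (hQ : volume Q ≠ ∞) (f : C(hull Λ, ℂ)) :
    ‖ContinuousMap.toLp 2 m ℂ (averageMap ξ Q f)‖ ≤ ‖ContinuousMap.toLp 2 m ℂ f‖ := by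
  have h := toLp_averageMap hm ξ hQ f (ContinuousLinearMap.id ℂ _)
  simp only [ContinuousLinearMap.id_apply] at h
  have h' := norm_setIntegral_le_of_norm_le_const (C := ‖ContinuousMap.toLp 2 m ℂ f‖)
    (f := fun s => twistedKoopman hm ξ s (ContinuousMap.toLp 2 m ℂ f)) hQ.lt_top
    fun s _ => ((twistedKoopman hm ξ s).norm_map _).le
  rw [h, norm_smul, norm_inv, Complex.norm_real, Real.norm_of_nonneg ENNReal.toReal_nonneg]
  rcases eq_or_lt_of_le (ENNReal.toReal_nonneg (a := volume Q)) with h0 | h0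
  · rw [← h0, inv_zero, zero_mul]
    exact norm_nonneg _
  · rw [inv_mul_le_iff₀ h0, mul_comm]
    exact h'

/-- The projection takes the same value on every twisted translate of `f`, hence also on the
average, and it is a contraction. -/
theorem norm_starProjection_le_norm_toLp_averageMap
    (hm : ∀ t, MeasurePreserving (shift Λ t) m m) (ξ : Eu d) {Q : Set (Eu d)}
    (hQ : volume Q ≠ ∞) (hQ0 : (volume Q).toReal ≠ 0) (f : C(hull Λ, ℂ)) :
    ‖(eigenspace hm ξ).toSubmodule.starProjection (ContinuousMap.toLp 2 m ℂ f)‖ ≤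
      ‖ContinuousMap.toLp 2 m ℂ (averageMap ξ Q f)‖ := by
  have h := toLp_averageMap hm ξ hQ f (eigenspace hm ξ).toSubmodule.starProjection
  simp only [starProjection_twistedKoopman] at h
  rw [setIntegral_const, Measure.real, ← Complex.coe_smul, smul_smul, inv_mul_cancel₀
    (Complex.ofReal_ne_zero.2 hQ0), one_smul] at h
  rw [← h]
  exact Submodule.norm_starProjection_apply_le _ _

theorem tendsto_averageMap_twist_sub (ξ t : Eu d) (f : C(hull Λ, ℂ)) :
    Tendsto (fun n : ℕ => averageMap ξ (cube d (n + 1)) (twist ξ f t) -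
      averageMap ξ (cube d (n + 1)) f) atTop (𝓝 0) := by
  refine (tendsto_cube_translate (continuous_twist ξ f) (norm_twist_le ξ f) t).congr fun n => ?_
  have h : twist ξ (twist ξ f t) = fun s => twist ξ f (s + t) :=
    funext fun s => twist_twist ξ f s t
  rw [averageMap, averageMap, h, ← smul_sub, Measure.real, ← Complex.ofReal_inv, Complex.coe_smul]

/-- If `|A_Q f|` converges to a constant along the cubes, the constant is the norm of the
projection of `f` onto the eigenspace. -/
theorem eq_norm_starProjection (hm : ∀ t, MeasurePreserving (shift Λ t) m m) (ξ : Eu d)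
    (f : C(hull Λ, ℂ)) {c : ℝ}
    (hc : ∀ Γ, Tendsto (fun n : ℕ => ‖averageMap ξ (cube d (n + 1)) f Γ‖) atTop (𝓝 c)) :
    c = ‖(eigenspace hm ξ).toSubmodule.starProjection (ContinuousMap.toLp 2 m ℂ f)‖ := by
  set F : Lp ℂ 2 m := ContinuousMap.toLp 2 m ℂ f with hF
  have hc0 : 0 ≤ c := ge_of_tendsto' (hc (basePoint Λ)) fun n => norm_nonneg _
  have hnorm_sq : ∀ g : C(hull Λ, ℂ), ‖ContinuousMap.toLp 2 m ℂ g‖ ^ 2 = ∫ Γ, ‖g Γ‖ ^ 2 ∂m := by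
    intro g
    have h1 := ContinuousMap.inner_toLp (𝕜 := ℂ) (μ := m) g g
    rw [inner_self_eq_norm_sq_to_K] at h1
    have h2 : ∀ Γ, g Γ * (starRingEnd ℂ) (g Γ) = ((‖g Γ‖ ^ 2 : ℝ) : ℂ) := fun Γ => by
      rw [Complex.mul_conj, Complex.normSq_eq_norm_sq]
    simp only [h2] at h1
    rw [integral_complex_ofReal] at h1
    exact Complex.ofReal_injective ((Complex.ofReal_pow _ _).trans h1)
  -- The moduli are bounded by `‖f‖` and tend to the constant `c`; on a probability space their L²
  -- norms tend to `c`.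
  have hlim : Tendsto (fun n : ℕ => ‖ContinuousMap.toLp 2 m ℂ
      (averageMap ξ (cube d (n + 1)) f)‖) atTop (𝓝 c) := by
    have h1 : Tendsto (fun n : ℕ => ‖ContinuousMap.toLp 2 m ℂ
        (averageMap ξ (cube d (n + 1)) f)‖ ^ 2) atTop (𝓝 (∫ _Γ : hull Λ, c ^ 2 ∂m)) := by
      simp only [hnorm_sq]
      refine tendsto_integral_of_dominated_convergence (fun _ => ‖f‖ ^ 2) (fun n => ?_)
        (integrable_const _) (fun n => Eventually.of_forall fun Γ => ?_)
        (Eventually.of_forall fun Γ => (hc Γ).pow 2)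
      · exact (by fun_prop : Continuous fun Γ =>
          ‖averageMap ξ (cube d (n + 1)) f Γ‖ ^ 2).aestronglyMeasurable
      · rw [Real.norm_of_nonneg (by positivity)]
        have := (ContinuousMap.norm_coe_le_norm _ Γ).trans
          (norm_averageMap_le ξ (volume_cube_ne_top (d := d) (n + 1)) f)
        gcongr
    rw [integral_const, probReal_univ, one_smul] at h1
    have h2 := h1.sqrt
    simpa only [Real.sqrt_sq (norm_nonneg _), Real.sqrt_sq hc0] using h2
  refine le_antisymm ?_ (ge_of_tendsto' hlim fun n =>
    norm_starProjection_le_norm_toLp_averageMap hm ξ (volume_cube_ne_top _) ?_ f)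
  -- The functions with asymptotically the same averages as `f`. This set is convex and contains the
  -- twisted orbit of `f`, so its closure contains the projection, and `c` bounds its norms from
  -- below.
  · set S : Set (Lp ℂ 2 m) := {w | ∃ φ : C(hull Λ, ℂ), ContinuousMap.toLp 2 m ℂ φ = w ∧
      Tendsto (fun n : ℕ => averageMap ξ (cube d (n + 1)) φ - averageMap ξ (cube d (n + 1)) f)
        atTop (𝓝 0)} with hS
    have hle : ∀ w ∈ S, c ≤ ‖w‖ := by
      rintro _ ⟨φ, rfl, hφ⟩
      have h1 : Tendsto (fun n : ℕ => ‖ContinuousMap.toLp 2 m ℂ φ‖ +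
          ‖ContinuousMap.toLp 2 m ℂ (averageMap ξ (cube d (n + 1)) φ -
            averageMap ξ (cube d (n + 1)) f)‖) atTop (𝓝 (‖ContinuousMap.toLp 2 m ℂ φ‖ + 0)) := by
        refine Tendsto.const_add _ ?_
        have := (((ContinuousMap.toLp (E := ℂ) 2 m ℂ).continuous.tendsto 0).comp hφ).norm
        simpa using this
      rw [add_zero] at h1
      refine le_of_tendsto_of_tendsto' hlim h1 fun n => ?_
      have h2 := norm_toLp_averageMap_le hm ξ (volume_cube_ne_top (d := d) (n + 1)) φ
      have h3 := norm_sub_norm_le (ContinuousMap.toLp 2 m ℂ (averageMap ξ (cube d (n + 1)) f))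
        (ContinuousMap.toLp 2 m ℂ (averageMap ξ (cube d (n + 1)) φ))
      rw [norm_sub_rev, ← map_sub] at h3
      linarith
    have hmem : (eigenspace hm ξ).toSubmodule.starProjection F ∈ closure S := by
      refine starProjection_mem_closure_of_convex (twistedKoopman hm ξ) _
        (mem_eigenspace_iff_twistedKoopman hm ξ) (fun s t => ?_) (fun t => ?_) ?_
      · rw [hF, twistedKoopman_toLp, twistedKoopman_toLp, twistedKoopman_toLp, twist_twist]
      · exact ⟨twist ξ f t, (twistedKoopman_toLp hm ξ t f).symm,
          tendsto_averageMap_twist_sub ξ t f⟩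
      · rintro _ ⟨φ, rfl, hφ⟩ _ ⟨ψ, rfl, hψ⟩ a b - - hab
        refine ⟨(a : ℂ) • φ + (b : ℂ) • ψ, by simp only [map_add, map_smul], ?_⟩
        have h := (hφ.const_smul (a : ℂ)).add (hψ.const_smul (b : ℂ))
        rw [smul_zero, smul_zero, add_zero] at h
        refine h.congr fun n => ?_
        have hab' : (b : ℂ) = 1 - a := by
          rw [eq_sub_iff_add_eq', ← Complex.ofReal_add, hab, Complex.ofReal_one]
        rw [averageMap_add_smul ξ (volume_cube_ne_top _), hab']
        module
    exact closure_minimal (t := {w | c ≤ ‖w‖}) hle (isClosed_le continuous_const continuous_norm) hmem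
  · have hn : (0 : ℝ) < n + 1 := by positivity
    have := volume_real_cube (d := d) hn.le
    rw [Measure.real] at this
    rw [this]
    positivity

end Ergodic

/-! ### The spectral measure of a point -/

section Spectral

variable {X : Type*} [MeasurableSpace X] {H : Type*} [NormedAddCommGroup H]
  [InnerProductSpace ℂ H] [CompleteSpace H]

theorem ProjectionValuedMeasure.inner_proj_left (E : ProjectionValuedMeasure X H) {B : Set X}
    (hB : MeasurableSet B) (g h : H) : inner ℂ (E.proj B g) h = inner ℂ g (E.proj B h) := by
  have := ContinuousLinearMap.adjoint_inner_left (E.proj B) h g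
  rwa [← ContinuousLinearMap.star_eq_adjoint, (E.isStarProjection B hB).isSelfAdjoint.star_eq]
    at this

theorem ProjectionValuedMeasure.proj_proj (E : ProjectionValuedMeasure X H) {B : Set X}
    (hB : MeasurableSet B) (g : H) : E.proj B (E.proj B g) = E.proj B g :=
  DFunLike.congr_fun (E.isStarProjection B hB).isIdempotentElem g

theorem ProjectionValuedMeasure.norm_proj_sq (E : ProjectionValuedMeasure X H) {B : Set X}
    (hB : MeasurableSet B) (g : H) : ‖E.proj B g‖ ^ 2 = (inner ℂ g (E.proj B g)).re := by
  rw [← inner_self_eq_norm_sq (𝕜 := ℂ), E.inner_proj_left hB, E.proj_proj hB]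
  rfl

theorem ProjectionValuedMeasure.diag_apply (E : ProjectionValuedMeasure X H) (g : H) {B : Set X}
    (hB : MeasurableSet B) : E.diag g B = ENNReal.ofReal (‖E.proj B g‖ ^ 2) := by
  rw [E.norm_proj_sq hB]
  exact Measure.ofMeasurable_apply B hB

instance (E : ProjectionValuedMeasure X H) (g : H) : IsFiniteMeasure (E.diag g) :=
  ⟨by rw [E.diag_apply g MeasurableSet.univ]; exact ENNReal.ofReal_lt_top⟩

theorem ProjectionValuedMeasure.proj_eq_self_iff (E : ProjectionValuedMeasure X H) {B : Set X}
    (hB : MeasurableSet B) (g : H) : E.proj B g = g ↔ ‖E.proj B g‖ ^ 2 = ‖g‖ ^ 2 := by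
  refine ⟨fun h => by rw [h], fun h => ?_⟩
  have h1 := norm_sub_sq (𝕜 := ℂ) g (E.proj B g)
  have h2 : RCLike.re (inner ℂ g (E.proj B g)) = ‖E.proj B g‖ ^ 2 := (E.norm_proj_sq hB g).symm
  have h3 : ‖g - E.proj B g‖ ^ 2 = 0 := by rw [h1, h2, h]; ring
  have h4 := pow_eq_zero_iff two_ne_zero |>.1 h3
  exact (sub_eq_zero.1 (norm_eq_zero.1 h4)).symm

theorem ProjectionValuedMeasure.diag_proj_singleton [MeasurableSingletonClass X]
    (E : ProjectionValuedMeasure X H) (ξ : X) (g : H) :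
    E.diag (E.proj {ξ} g) = ENNReal.ofReal (‖E.proj {ξ} g‖ ^ 2) • Measure.dirac ξ := by
  ext B hB
  have h : E.proj B (E.proj {ξ} g) = E.proj (B ∩ {ξ}) g := by
    rw [E.inter B {ξ} hB (measurableSet_singleton ξ)]; rfl
  rw [E.diag_apply _ hB, h, Measure.smul_apply, Measure.dirac_apply' ξ hB, smul_eq_mul]
  by_cases hξ : ξ ∈ B
  · rw [Set.inter_eq_right.2 (Set.singleton_subset_iff.2 hξ), Set.indicator_of_mem hξ,
      Pi.one_apply, mul_one]
  · rw [Set.inter_singleton_eq_empty.2 hξ, E.empty, Set.indicator_of_notMem hξ]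
    simp

variable {Λ : Delone.DeloneSet (Eu d)} {m : Measure (hull Λ)}

theorem integral_char_smul_dirac (ξ t : Eu d) {a : ℝ} (ha : 0 ≤ a) :
    ∫ η, char η t ∂(ENNReal.ofReal a • Measure.dirac ξ) = a * char ξ t := by
  rw [integral_smul_measure, integral_dirac, ENNReal.toReal_ofReal ha, ← Complex.coe_smul,
    smul_eq_mul]

/-- For `g` in the range, `E.diag g` is a point mass at `ξ`, so ⟨g, T_t g⟩ = ‖g‖² (ξ, t). This is
equality in Cauchy–Schwarz, which forces T_t g = (ξ, t) g. -/
theorem proj_singleton_mem_eigenspace (hm : ∀ t, MeasurePreserving (shift Λ t) m m)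
    {E : ProjectionValuedMeasure (Eu d) (Lp ℂ 2 m)} (hE : IsSpectralMeasure hm E) (ξ : Eu d)
    (f : Lp ℂ 2 m) : E.proj {ξ} f ∈ (eigenspace hm ξ).toSubmodule := by
  rw [mem_eigenspace_iff]
  intro t
  set g := E.proj {ξ} f with hg
  have h1 : inner ℂ g (koopman hm t g) = ((‖g‖ ^ 2 : ℝ) : ℂ) * char ξ t := by
    rw [hE g t, hg, E.diag_proj_singleton, integral_char_smul_dirac ξ t (sq_nonneg _)]
  have h2 : RCLike.re (inner ℂ (koopman hm t g) (char ξ t • g)) = ‖g‖ ^ 2 := by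
    rw [inner_smul_right, ← inner_conj_symm, h1, map_mul (starRingEnd ℂ), mul_comm, mul_assoc,
      star_char_mul_char, mul_one, Complex.conj_ofReal]
    exact Complex.ofReal_re _
  have h3 := norm_sub_sq (𝕜 := ℂ) (koopman hm t g) (char ξ t • g)
  rw [h2, norm_smul, norm_char, one_mul, LinearIsometry.norm_map] at h3
  have h4 : ‖koopman hm t g - char ξ t • g‖ ^ 2 = 0 := by rw [h3]; ring
  exact sub_eq_zero.1 (norm_eq_zero.1 (pow_eq_zero_iff two_ne_zero |>.1 h4))

/-- For an eigenvector, `E.diag g` has the characteristic function of a point mass at `ξ` with total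
mass ‖g‖², so it is that measure and the projection preserves the norm of `g`. -/
theorem proj_singleton_of_mem_eigenspace (hm : ∀ t, MeasurePreserving (shift Λ t) m m)
    {E : ProjectionValuedMeasure (Eu d) (Lp ℂ 2 m)} (hE : IsSpectralMeasure hm E) {ξ : Eu d}
    {g : Lp ℂ 2 m} (hg : g ∈ (eigenspace hm ξ).toSubmodule) : E.proj {ξ} g = g := by
  rw [mem_eigenspace_iff] at hg
  rw [E.proj_eq_self_iff (measurableSet_singleton ξ)]
  have hfin : IsFiniteMeasure (ENNReal.ofReal (‖g‖ ^ 2) • Measure.dirac ξ) :=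
    Measure.smul_finite _ ENNReal.ofReal_ne_top
  have hdiag : E.diag g = ENNReal.ofReal (‖g‖ ^ 2) • Measure.dirac ξ := by
    refine Measure.ext_of_charFun (funext fun t => ?_)
    have hchar : ∀ μ : Measure (Eu d), charFun μ t = ∫ η, char η t ∂μ := fun μ => by
      simp only [charFun_apply, char, mul_comm]
    rw [hchar, hchar, ← hE g t, hg t, inner_smul_right, inner_self_eq_norm_sq_to_K,
      integral_char_smul_dirac ξ t (sq_nonneg _), mul_comm]
    simp
  have h := congrArg (fun μ => μ {ξ}) hdiag
  simp only [E.diag_apply g (measurableSet_singleton ξ), Measure.smul_apply, smul_eq_mul,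
    Measure.dirac_apply_of_mem (Set.mem_singleton ξ), mul_one] at h
  exact (ENNReal.ofReal_eq_ofReal_iff (sq_nonneg _) (sq_nonneg _)).1 h

/-- The value of the spectral measure at `{ξ}` is the projection onto the eigenspace of `ξ`. -/
theorem starProjection_eigenspace_eq (hm : ∀ t, MeasurePreserving (shift Λ t) m m)
    {E : ProjectionValuedMeasure (Eu d) (Lp ℂ 2 m)} (hE : IsSpectralMeasure hm E) (ξ : Eu d)
    (f : Lp ℂ 2 m) : (eigenspace hm ξ).toSubmodule.starProjection f = E.proj {ξ} f := by
  have hξ : MeasurableSet ({ξ} : Set (Eu d)) := measurableSet_singleton ξ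
  refine Submodule.eq_starProjection_of_mem_of_inner_eq_zero
    (proj_singleton_mem_eigenspace hm hE ξ f) fun w hw => ?_
  rw [← proj_singleton_of_mem_eigenspace hm hE hw, ← E.inner_proj_left hξ, map_sub,
    E.proj_proj hξ, sub_self, inner_zero_left]

end Spectral

end LinRep

end

/-! ### The main theorem -/

open LinRep in
theorem theorem11 {d : ℕ} (Λ : Delone.DeloneSet (EuclideanSpace ℝ (Fin d)))
    (hΛ : LinearlyRepetitive Λ) (f : C(hull Λ, ℂ)) (ξ : EuclideanSpace ℝ (Fin d)) :
    ∃ c : ℝ,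
      (∀ (r : ℕ → ℝ) (Q : ℕ → Set (EuclideanSpace ℝ (Fin d))),
        Tendsto r atTop atTop → (∀ n, Q n ∈ boxes d (r n)) →
          TendstoUniformly (fun n Γ => ‖average ξ (Q n) f Γ‖) (fun _ => c) atTop) ∧
      ∀ (m : Measure (hull Λ)) [IsProbabilityMeasure m]
        (hm : ∀ t, MeasurePreserving (shift Λ t) m m),
        ∃ hf : MemLp f 2 m,
          c = ‖(eigenspace hm ξ).toSubmodule.starProjection (hf.toLp f)‖ ∧
          ∀ E : ProjectionValuedMeasure (EuclideanSpace ℝ (Fin d)) (Lp ℂ 2 m),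
            IsSpectralMeasure hm E → c = ‖E.proj {ξ} (hf.toLp f)‖ := by
  obtain ⟨c, hc⟩ := exists_tendstoUniformly_norm_average hΛ f ξ
  refine ⟨c, hc, fun m _ hm => ?_⟩
  have hae := ContinuousMap.coeFn_toLp (p := 2) (𝕜 := ℂ) m f
  have hf : MemLp f 2 m := (memLp_congr_ae hae).1 (Lp.memLp _)
  have htoLp : hf.toLp f = ContinuousMap.toLp 2 m ℂ f :=
    Lp.ext (hf.coeFn_toLp.trans hae.symm)
  -- The cubes of half-side `n + 1` are admissible boxes, so `c` can be computed along them.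
  have hρ : Tendsto (fun n : ℕ => 2 * ((n : ℝ) + 1)) atTop atTop :=
    (tendsto_natCast_atTop_atTop.atTop_add tendsto_const_nhds).const_mul_atTop two_pos
  have hunif := hc (fun n => 2 * ((n : ℝ) + 1)) (fun n => cube d (n + 1)) hρ
    fun n => cube_mem_boxes (by positivity)
  have heq : c = ‖(eigenspace hm ξ).toSubmodule.starProjection (hf.toLp f)‖ := by
    rw [htoLp]
    refine eq_norm_starProjection hm ξ f fun Γ => ?_
    simpa only [averageMap_apply ξ (volume_cube_ne_top _)] using hunif.tendsto_at Γ
  exact ⟨hf, heq, fun E hE => by rw [heq, starProjection_eigenspace_eq hm hE ξ]⟩
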